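/- A $k$-ranking of a finite simple graph $G$ is a labeling $f : V(G) \to \{1, \dots, k\}$ such that every path joining two distinct vertices with the same label passes through a vertex with a strictly larger label. The rank number of $G$ is the smallest $k$ for which $G$ has a $k$-ranking. For $m, n \ge 1$ let $G_{m,n}$ be the $m \times n$ grid graph, i.e. the Cartesian product of a path on $m$ vertices and a path on $n$ vertices, and let $r(m,n)$ be its rank number. Then for every integer $m \ge 1$, $$ r(m,m) \;\ge\; \frac{5}{3}\, m - \frac{25}{9}. $$ -/

import Mathlib

/-- A `k`-ranking of a graph: a labeling of the vertices by `1, …, k` such that every path joining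
two distinct vertices with the same label passes through a vertex with a larger label. -/
def IsRanking {V : Type*} (G : SimpleGraph V) (k : ℕ) (f : V → ℕ) : Prop :=
  (∀ v, 1 ≤ f v ∧ f v ≤ k) ∧
    ∀ u v, u ≠ v → f u = f v → ∀ p : G.Walk u v, p.IsPath → ∃ w ∈ p.support, f u < f w

/-- The rank number of a graph: the smallest `k` for which a `k`-ranking exists. -/
noncomputable def rankNumber {V : Type*} (G : SimpleGraph V) : ℕ :=
  sInf {k | ∃ f : V → ℕ, IsRanking G k f}

/-- A finite graph has a ranking (label all vertices differently), so the infimum defining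
`rankNumber` is a minimum over a nonempty set. -/
theorem isLeast_rankNumber {V : Type*} [Finite V] (G : SimpleGraph V) :
    IsLeast {k | ∃ f : V → ℕ, IsRanking G k f} (rankNumber G) := by
  have hne : {k | ∃ f : V → ℕ, IsRanking G k f}.Nonempty := by
    refine ⟨Nat.card V, fun v => (Finite.equivFin V v : ℕ) + 1, fun v => ⟨Nat.le_add_left 1 _, ?_⟩, ?_⟩
    · exact (Finite.equivFin V v).isLt
    · intro u v huv h
      exact absurd ((Finite.equivFin V).injective (Fin.ext (by simpa using h))) huv
  exact ⟨Nat.sInf_mem hne, fun k hk => Nat.sInf_le hk⟩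

/-- The `m × n` grid graph, the Cartesian product of the paths on `m` and on `n` vertices. -/
def gridGraph (m n : ℕ) : SimpleGraph (Fin m × Fin n) :=
  (SimpleGraph.pathGraph m).boxProd (SimpleGraph.pathGraph n)

/-! A label and a deleted vertex are given the same price. A `Config` consists of deleted vertices
`H` and a ranking with `k` labels of the part still joined to the border, and the sum `H.card + k`
is bounded from below. If that outer part is connected, its largest label occurs only once; deleting
the vertex that carries it lowers `k` by one and keeps the sum (`Config.exists_insert`). Such trades
go on until one of two things happens.

Either `H` has enough vertices on the border, and then layers are peeled off: a vertex of the new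
border that is enclosed by `H` forces vertices of `H` in its row and column, and these pay for the
next layer. Once no border vertex is enclosed, the smaller rectangle carries a configuration with
the same `k`, and induction applies. Or `H` separates two opposite sides, and then by planar duality
(`exists_kingPath_of_separated`) it contains a path of king moves across the rectangle. If this path
avoids a window at a wall, the bound for that window is added to the number of its vertices.

For rectangles this gives `min a (2 * b)` (`bound_rect`). In a square, let the path have `n ≥ m - 1`
steps and let `q` be about `(3m - n) / 6`. If it misses some window of width `q` and height `2q` at
the left or right wall, the sum is at least `2q + n + 1`, about `m + 2n/3 ≥ 5m/3`. If it meets all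
these windows, it has to cross and turn back so much that `n > 3m - 6q` (`le_of_visits`), against
the choice of `q`. -/

namespace GridRank

/-! ### Lattice walks and rankings of lattice sets. -/

/-- Adjacency in the square lattice. -/
def Adj (p q : ℤ × ℤ) : Prop :=
  (p.1 = q.1 ∧ (q.2 = p.2 + 1 ∨ p.2 = q.2 + 1)) ∨ (p.2 = q.2 ∧ (q.1 = p.1 + 1 ∨ p.1 = q.1 + 1))

theorem Adj.symm {p q : ℤ × ℤ} (h : Adj p q) : Adj q p := by
  unfold Adj at *; omega

/-- `Reach A u v`: `u` and `v` are joined by a lattice walk inside `A`. -/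
def Reach (A : Set (ℤ × ℤ)) : ℤ × ℤ → ℤ × ℤ → Prop :=
  Relation.ReflTransGen fun u v => Adj u v ∧ u ∈ A ∧ v ∈ A

theorem Reach.symm {A : Set (ℤ × ℤ)} {u v : ℤ × ℤ} (h : Reach A u v) : Reach A v u := by
  induction h with
  | refl => exact .refl
  | tail _ h ih => exact .head ⟨h.1.symm, h.2.2, h.2.1⟩ ih

theorem Reach.mono {A B : Set (ℤ × ℤ)} (hAB : A ⊆ B) {u v : ℤ × ℤ} (h : Reach A u v) :
    Reach B u v := by
  induction h with
  | refl => exact .refl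
  | tail _ h ih => exact ih.tail ⟨h.1, hAB h.2.1, hAB h.2.2⟩

theorem Reach.trans {A : Set (ℤ × ℤ)} {u v w : ℤ × ℤ} (h : Reach A u v) (h' : Reach A v w) :
    Reach A u w :=
  Relation.ReflTransGen.trans h h'

theorem Reach.mem {A : Set (ℤ × ℤ)} {u v : ℤ × ℤ} (h : Reach A u v) (hu : u ∈ A) : v ∈ A := by
  induction h with
  | refl => exact hu
  | tail _ h _ => exact h.2.2

theorem reach_row {A : Set (ℤ × ℤ)} {x y : ℤ} (n : ℕ)
    (h : ∀ x', x ≤ x' → x' ≤ x + n → (x', y) ∈ A) : Reach A (x, y) (x + n, y) := by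
  induction n with
  | zero => rw [Nat.cast_zero, add_zero]; exact .refl
  | succ n ih =>
    refine (ih fun x' h1 h2 => h x' h1 (by push_cast; omega)).trans (.single ⟨?_, ?_, ?_⟩)
    · right; exact ⟨rfl, .inl (by push_cast; ring)⟩
    · exact h _ (by omega) (by push_cast; omega)
    · exact h _ (by push_cast; omega) le_rfl

theorem reach_col {A : Set (ℤ × ℤ)} {x y : ℤ} (n : ℕ)
    (h : ∀ y', y ≤ y' → y' ≤ y + n → (x, y') ∈ A) : Reach A (x, y) (x, y + n) := by
  induction n with
  | zero => rw [Nat.cast_zero, add_zero]; exact .refl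
  | succ n ih =>
    refine (ih fun y' h1 h2 => h y' h1 (by push_cast; omega)).trans (.single ⟨?_, ?_, ?_⟩)
    · left; exact ⟨rfl, .inl (by push_cast; ring)⟩
    · exact h _ (by omega) (by push_cast; omega)
    · exact h _ (by push_cast; omega) le_rfl

theorem reach_row' {A : Set (ℤ × ℤ)} {x₁ x₂ y : ℤ} (hx : x₁ ≤ x₂)
    (h : ∀ x', x₁ ≤ x' → x' ≤ x₂ → (x', y) ∈ A) : Reach A (x₁, y) (x₂, y) := by
  obtain ⟨n, rfl⟩ := Int.le.dest hx
  exact reach_row n h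

theorem reach_col' {A : Set (ℤ × ℤ)} {x y₁ y₂ : ℤ} (hy : y₁ ≤ y₂)
    (h : ∀ y', y₁ ≤ y' → y' ≤ y₂ → (x, y') ∈ A) : Reach A (x, y₁) (x, y₂) := by
  obtain ⟨n, rfl⟩ := Int.le.dest hy
  exact reach_col n h

/-- The subgraph of the lattice induced on `A` has a ranking with labels `1, …, k`. -/
def Ranked (A : Set (ℤ × ℤ)) (k : ℕ) : Prop :=
  ∃ f : ℤ × ℤ → ℕ, (∀ v ∈ A, 1 ≤ f v ∧ f v ≤ k) ∧
    ∀ u ∈ A, ∀ v ∈ A, u ≠ v → f u = f v → ¬ Reach {w | w ∈ A ∧ f w ≤ f u} u v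

theorem Ranked.mono {A B : Set (ℤ × ℤ)} {k : ℕ} (hAB : A ⊆ B) (h : Ranked B k) : Ranked A k := by
  obtain ⟨f, h1, h2⟩ := h
  exact ⟨f, fun v hv => h1 v (hAB hv), fun u hu v hv huv huv' hr =>
    h2 u (hAB hu) v (hAB hv) huv huv' (hr.mono (by exact fun w hw => ⟨hAB hw.1, hw.2⟩))⟩

/-- A vertex with the largest label of a connected set is unique; deleting it saves one label. -/
theorem Ranked.exists_erase {A : Set (ℤ × ℤ)} {k : ℕ} (h : Ranked A k) (hne : A.Nonempty)
    (hconn : ∀ u ∈ A, ∀ v ∈ A, Reach A u v) :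
    ∃ k', k = k' + 1 ∧ ∃ v ∈ A, Ranked (A \ {v}) k' := by
  obtain ⟨f, h1, h2⟩ := h
  have hb : BddAbove (f '' A) := ⟨k, by rintro _ ⟨v, hv, rfl⟩; exact (h1 v hv).2⟩
  obtain ⟨v, hv, hvm⟩ := Nat.sSup_mem (hne.image f) hb
  have hmax : ∀ w ∈ A, f w ≤ f v := fun w hw => hvm ▸ le_csSup hb ⟨w, hw, rfl⟩
  have huniq : ∀ w ∈ A, w ≠ v → f w ≠ f v := fun w hw hwv he =>
    h2 w hw v hv hwv he ((hconn w hw v hv).mono (by exact fun z hz => ⟨hz, he ▸ hmax z hz⟩))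
  obtain ⟨k', rfl⟩ := Nat.exists_eq_succ_of_ne_zero (n := k) (by have := h1 v hv; omega)
  refine ⟨k', rfl, v, hv, f, fun w hw => ⟨(h1 w hw.1).1, ?_⟩, fun u hu w hw huw he hr =>
    h2 u hu.1 w hw.1 huw he (hr.mono (by exact fun z hz => ⟨hz.1.1, hz.2⟩))⟩
  have := hmax w hw.1
  have := huniq w hw.1 hw.2
  have := (h1 v hv).2
  omega

/-! ### Outer part and pockets. -/

/-- The vertices of `R` outside `H` that are joined to the border of `R` in `R \ H`. -/
def Outer (R H : Set (ℤ × ℤ)) : Set (ℤ × ℤ) :=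
  {z | z ∈ R \ H ∧ ∃ w n, Adj w n ∧ n ∉ R ∧ w ∈ R \ H ∧ Reach (R \ H) z w}

/-- The vertices of `R` outside `H` that `H` separates from the border of `R`. -/
def Pocket (R H : Set (ℤ × ℤ)) (z : ℤ × ℤ) : Prop := z ∈ R \ H ∧ z ∉ Outer R H

theorem mem_outer_of_adj {R H : Set (ℤ × ℤ)} {z n : ℤ × ℤ} (hz : z ∈ R \ H) (h : Adj z n)
    (hn : n ∉ R) : z ∈ Outer R H :=
  ⟨hz, z, n, h, hn, hz, .refl⟩

theorem mem_outer_of_reach {R H : Set (ℤ × ℤ)} {z z' : ℤ × ℤ} (hz : z ∈ R \ H)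
    (h : Reach (R \ H) z z') (h' : z' ∈ Outer R H) : z ∈ Outer R H := by
  obtain ⟨_, w, n, h1, h2, h3, h4⟩ := h'
  exact ⟨hz, w, n, h1, h2, h3, h.trans h4⟩

theorem outer_insert_subset {R H : Set (ℤ × ℤ)} {v : ℤ × ℤ} :
    Outer R (insert v H) ⊆ Outer R H \ {v} := by
  have hs : R \ insert v H ⊆ R \ H := fun z hz => ⟨hz.1, fun h => hz.2 (.inr h)⟩
  rintro z ⟨hz, w, n, h1, h2, h3, h4⟩
  exact ⟨⟨hs hz, w, n, h1, h2, hs h3, h4.mono hs⟩, fun h => hz.2 (.inl h)⟩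

/-- A vertex on the border of `W` that is not in `H` is outer in `R` unless it is a pocket vertex.
This is what lets a ranking pass to a smaller window, and why peeling only stops at a border without
pocket vertices. -/
theorem outer_inter_subset {R W H : Set (ℤ × ℤ)} (hW : W ⊆ R)
    (h : ∀ z ∈ W, ∀ n, Adj z n → n ∉ W → ¬ Pocket R H z) : Outer W (H ∩ W) ⊆ Outer R H := by
  have hs : W \ (H ∩ W) ⊆ R \ H := fun z hz => ⟨hW hz.1, fun h => hz.2 ⟨h, hz.1⟩⟩
  rintro z ⟨hz, w, n, h1, h2, h3, h4⟩
  refine mem_outer_of_reach (hs hz) (h4.mono hs) ?_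
  by_contra hw
  exact h w h3.1 n h1 h2 ⟨hs h3, hw⟩

theorem Pocket.step {R H : Set (ℤ × ℤ)} {z n : ℤ × ℤ} (h : Pocket R H z) (ha : Adj z n) :
    n ∈ H ∨ Pocket R H n := by
  by_cases hn : n ∈ R
  · by_cases hH : n ∈ H
    · exact .inl hH
    · exact .inr ⟨⟨hn, hH⟩, fun ho => h.2 (mem_outer_of_reach h.1 (.single ⟨ha, h.1, hn, hH⟩) ho)⟩
  · exact absurd (mem_outer_of_adj h.1 ha hn) h.2

/-! ### Pockets in rectangles. -/

/-- The rectangle with `a` columns and `b` rows and smallest corner `(x, y)`. -/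
def rect (x y : ℤ) (a b : ℕ) : Set (ℤ × ℤ) :=
  {z | (x ≤ z.1 ∧ z.1 < x + a) ∧ y ≤ z.2 ∧ z.2 < y + b}

theorem mem_rect {x y : ℤ} {a b : ℕ} {z : ℤ × ℤ} :
    z ∈ rect x y a b ↔ (x ≤ z.1 ∧ z.1 < x + a) ∧ y ≤ z.2 ∧ z.2 < y + b := Iff.rfl

theorem side_of_adj {x y : ℤ} {a b : ℕ} {z n : ℤ × ℤ} (hz : z ∈ rect x y a b) (h : Adj z n)
    (hn : n ∉ rect x y a b) : z.1 = x ∨ z.1 = x + a - 1 ∨ z.2 = y ∨ z.2 = y + b - 1 := by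
  rw [mem_rect] at hz hn; unfold Adj at h; omega

theorem not_pocket_of_side {x y : ℤ} {a b : ℕ} {H : Set (ℤ × ℤ)} {z : ℤ × ℤ}
    (h : z.1 = x ∨ z.1 = x + a - 1 ∨ z.2 = y ∨ z.2 = y + b - 1) :
    ¬ Pocket (rect x y a b) H z := by
  intro hp
  obtain ⟨n, h1, h2⟩ : ∃ n, Adj z n ∧ n ∉ rect x y a b := by
    rcases h with h | h | h | h
    · exact ⟨(z.1 - 1, z.2), by simp [Adj], by rw [mem_rect]; dsimp only; omega⟩
    · exact ⟨(z.1 + 1, z.2), by simp [Adj], by rw [mem_rect]; dsimp only; omega⟩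
    · exact ⟨(z.1, z.2 - 1), by simp [Adj], by rw [mem_rect]; dsimp only; omega⟩
    · exact ⟨(z.1, z.2 + 1), by simp [Adj], by rw [mem_rect]; dsimp only; omega⟩
  exact hp.2 (mem_outer_of_adj hp.1 h1 h2)

/-- A straight walk from a pocket vertex stays in the pocket until it hits `H`: leaving the
rectangle first would make the vertex outer. The peeling arguments get their elements of `H` from
here, in the four directions. -/
theorem Pocket.run {x y : ℤ} {a b : ℕ} {H : Set (ℤ × ℤ)} {z d : ℤ × ℤ}
    (h : Pocket (rect x y a b) H z) (hd : ∀ z, Adj z (z + d)) :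
    ∃ n : ℕ, 1 ≤ n ∧ z + n • d ∈ H ∧ ∀ i < n, Pocket (rect x y a b) H (z + i • d) := by
  classical
  have hex : ∃ i : ℕ, ¬ Pocket (rect x y a b) H (z + i • d) := by
    -- So many unit steps leave the rectangle in any direction.
    refine ⟨a + b + 1, fun hp => ?_⟩
    have h1 := hp.1.1
    have h2 := h.1.1
    have h3 := hd 0
    have e1 : (z + (a + b + 1) • d).1 = z.1 + (a + b + 1 : ℤ) * d.1 := by
      rw [Prod.fst_add, Prod.smul_fst, nsmul_eq_mul]; push_cast; ring
    have e2 : (z + (a + b + 1) • d).2 = z.2 + (a + b + 1 : ℤ) * d.2 := by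
      rw [Prod.snd_add, Prod.smul_snd, nsmul_eq_mul]; push_cast; ring
    rw [mem_rect] at h1 h2
    rw [e1, e2] at h1
    unfold Adj at h3
    simp only [zero_add, Prod.fst_zero, Prod.snd_zero] at h3
    rcases h3 with ⟨_, h3 | h3⟩ | ⟨_, h3 | h3⟩
    · rw [h3] at h1; omega
    · rw [show d.2 = -1 by omega] at h1; omega
    · rw [h3] at h1; omega
    · rw [show d.1 = -1 by omega] at h1; omega
  refine ⟨Nat.find hex, ?_, ?_, fun i hi => not_not.1 (Nat.find_min hex hi)⟩
  · rw [Nat.one_le_iff_ne_zero]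
    intro h0
    have := Nat.find_spec hex
    rw [h0] at this
    simp [h] at this
  · obtain ⟨j, hj⟩ : ∃ j, Nat.find hex = j + 1 := by
      refine Nat.exists_eq_succ_of_ne_zero fun h0 => ?_
      have := Nat.find_spec hex
      rw [h0] at this
      simp [h] at this
    have hp : Pocket (rect x y a b) H (z + j • d) := not_not.1 (Nat.find_min hex (by omega))
    have hspec := Nat.find_spec hex
    have := hp.step (hd _)
    rw [show z + j • d + d = z + (j + 1) • d by rw [add_smul, one_smul, add_assoc], ← hj] at this
    exact this.resolve_right hspec

theorem Pocket.exists_right {x y : ℤ} {a b : ℕ} {H : Set (ℤ × ℤ)} {z : ℤ × ℤ}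
    (h : Pocket (rect x y a b) H z) :
    ∃ t, z.1 < t ∧ (t, z.2) ∈ H ∧ ∀ i, z.1 ≤ i → i < t → Pocket (rect x y a b) H (i, z.2) := by
  obtain ⟨n, h1, h2, h3⟩ := h.run (d := (1, 0)) fun z => by simp [Adj]
  have e : ∀ i : ℕ, z + i • ((1, 0) : ℤ × ℤ) = (z.1 + i, z.2) := fun i => by ext <;> simp
  simp only [e] at h2 h3
  refine ⟨z.1 + n, by omega, h2, fun i h4 h5 => ?_⟩
  have := h3 (i - z.1).toNat (by omega)
  rwa [show z.1 + ((i - z.1).toNat : ℤ) = i by omega] at this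

theorem Pocket.exists_left {x y : ℤ} {a b : ℕ} {H : Set (ℤ × ℤ)} {z : ℤ × ℤ}
    (h : Pocket (rect x y a b) H z) :
    ∃ t, t < z.1 ∧ (t, z.2) ∈ H ∧ ∀ i, t < i → i ≤ z.1 → Pocket (rect x y a b) H (i, z.2) := by
  obtain ⟨n, h1, h2, h3⟩ := h.run (d := (-1, 0)) fun z => by simp [Adj]
  have e : ∀ i : ℕ, z + i • ((-1, 0) : ℤ × ℤ) = (z.1 - i, z.2) := fun i => by
    ext <;> simp [sub_eq_add_neg]
  simp only [e] at h2 h3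
  refine ⟨z.1 - n, by omega, h2, fun i h4 h5 => ?_⟩
  have := h3 (z.1 - i).toNat (by omega)
  rwa [show z.1 - ((z.1 - i).toNat : ℤ) = i by omega] at this

theorem Pocket.exists_above {x y : ℤ} {a b : ℕ} {H : Set (ℤ × ℤ)} {z : ℤ × ℤ}
    (h : Pocket (rect x y a b) H z) :
    ∃ t, z.2 < t ∧ (z.1, t) ∈ H ∧ ∀ i, z.2 ≤ i → i < t → Pocket (rect x y a b) H (z.1, i) := by
  obtain ⟨n, h1, h2, h3⟩ := h.run (d := (0, 1)) fun z => by simp [Adj]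
  have e : ∀ i : ℕ, z + i • ((0, 1) : ℤ × ℤ) = (z.1, z.2 + i) := fun i => by ext <;> simp
  simp only [e] at h2 h3
  refine ⟨z.2 + n, by omega, h2, fun i h4 h5 => ?_⟩
  have := h3 (i - z.2).toNat (by omega)
  rwa [show z.2 + ((i - z.2).toNat : ℤ) = i by omega] at this

theorem Pocket.exists_below {x y : ℤ} {a b : ℕ} {H : Set (ℤ × ℤ)} {z : ℤ × ℤ}
    (h : Pocket (rect x y a b) H z) :
    ∃ t, t < z.2 ∧ (z.1, t) ∈ H ∧ ∀ i, t < i → i ≤ z.2 → Pocket (rect x y a b) H (z.1, i) := by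
  obtain ⟨n, h1, h2, h3⟩ := h.run (d := (0, -1)) fun z => by simp [Adj]
  have e : ∀ i : ℕ, z + i • ((0, -1) : ℤ × ℤ) = (z.1, z.2 - i) := fun i => by
    ext <;> simp [sub_eq_add_neg]
  simp only [e] at h2 h3
  refine ⟨z.2 - n, by omega, h2, fun i h4 h5 => ?_⟩
  have := h3 (z.2 - i).toNat (by omega)
  rwa [show z.2 - ((z.2 - i).toNat : ℤ) = i by omega] at this

/-! ### Configurations, symmetries, restriction and trading. -/

/-- A set `H` of deleted vertices of `R` such that the rest of `R`, without its pockets, has a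
ranking with `k` labels. -/
structure Config (R : Set (ℤ × ℤ)) (H : Finset (ℤ × ℤ)) (k : ℕ) : Prop where
  sub : (H : Set (ℤ × ℤ)) ⊆ R
  ranked : Ranked (Outer R H) k

/-- Every configuration in `R` has at least `c` deleted vertices and labels together. -/
def Bound (R : Set (ℤ × ℤ)) (c : ℕ) : Prop := ∀ H k, Config R H k → c ≤ H.card + k

section Symmetry

variable {σ : ℤ × ℤ ≃ ℤ × ℤ}

theorem Reach.image (hσ : ∀ p q, Adj p q → Adj (σ p) (σ q)) {A : Set (ℤ × ℤ)} {u v : ℤ × ℤ}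
    (h : Reach A u v) : Reach (σ '' A) (σ u) (σ v) := by
  induction h with
  | refl => exact .refl
  | tail _ h ih =>
    exact ih.tail ⟨hσ _ _ h.1, Set.mem_image_of_mem _ h.2.1, Set.mem_image_of_mem _ h.2.2⟩

theorem Reach.preimage (hσ' : ∀ p q, Adj (σ p) (σ q) → Adj p q) {A : Set (ℤ × ℤ)}
    {u v : ℤ × ℤ} (h : Reach (σ '' A) (σ u) (σ v)) : Reach A u v := by
  have := h.image (σ := σ.symm) fun p q hpq => hσ' _ _ (by simpa using hpq)
  simpa [← Set.image_comp] using this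

theorem Ranked.image (hσ' : ∀ p q, Adj (σ p) (σ q) → Adj p q) {A : Set (ℤ × ℤ)} {k : ℕ}
    (h : Ranked A k) : Ranked (σ '' A) k := by
  obtain ⟨f, h1, h2⟩ := h
  refine ⟨f ∘ σ.symm, ?_, ?_⟩
  · rintro _ ⟨v, hv, rfl⟩
    simpa using h1 v hv
  · rintro _ ⟨u, hu, rfl⟩ _ ⟨v, hv, rfl⟩ huv he hr
    simp only [Function.comp, Equiv.symm_apply_apply] at he hr
    refine h2 u hu v hv (fun h => huv (by rw [h])) he (Reach.preimage hσ' (hr.mono ?_))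
    rintro _ ⟨⟨w, hw, rfl⟩, hw'⟩
    exact ⟨w, ⟨hw, by simpa using hw'⟩, rfl⟩

theorem outer_image (hσ' : ∀ p q, Adj (σ p) (σ q) → Adj p q) {R H : Set (ℤ × ℤ)} :
    Outer (σ '' R) (σ '' H) ⊆ σ '' Outer R H := by
  rintro z ⟨hz, w, n, h1, h2, h3, h4⟩
  rw [← Set.image_sdiff σ.injective] at hz h3 h4
  obtain ⟨z, hz, rfl⟩ := hz
  obtain ⟨w, h3, rfl⟩ := h3
  obtain ⟨n, rfl⟩ := σ.surjective n
  exact ⟨z, ⟨hz, w, n, hσ' _ _ h1, fun h => h2 ⟨n, h, rfl⟩, h3, Reach.preimage hσ' h4⟩, rfl⟩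

theorem Config.image (hσ' : ∀ p q, Adj (σ p) (σ q) → Adj p q) {R R' : Set (ℤ × ℤ)}
    {H : Finset (ℤ × ℤ)} {k : ℕ} (hR : σ '' R = R') (h : Config R H k) :
    Config R' (H.map σ.toEmbedding) k := by
  subst hR
  have e : ((H.map σ.toEmbedding : Finset (ℤ × ℤ)) : Set (ℤ × ℤ)) = σ '' H := by simp
  refine ⟨by rw [e]; exact Set.image_mono h.sub, ?_⟩
  rw [e]
  exact (h.ranked.image hσ').mono (outer_image hσ')

/-- Reflection of the first coordinate. -/
def flipX (s : ℤ) : ℤ × ℤ ≃ ℤ × ℤ := (Equiv.subLeft s).prodCongr (Equiv.refl ℤ)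

/-- Reflection of the second coordinate. -/
def flipY (s : ℤ) : ℤ × ℤ ≃ ℤ × ℤ := (Equiv.refl ℤ).prodCongr (Equiv.subLeft s)

@[simp] theorem flipX_apply (s : ℤ) (z : ℤ × ℤ) : flipX s z = (s - z.1, z.2) := rfl

@[simp] theorem flipY_apply (s : ℤ) (z : ℤ × ℤ) : flipY s z = (z.1, s - z.2) := rfl

variable {x y : ℤ} {a b : ℕ} {H : Finset (ℤ × ℤ)} {k : ℕ}

theorem Config.flipX (h : Config (rect x y a b) H k) :
    Config (rect x y a b) (H.map (flipX (2 * x + a - 1)).toEmbedding) k := by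
  refine h.image (fun p q => by simp only [flipX_apply, Adj]; omega) ?_
  ext z
  rw [Equiv.image_eq_preimage_symm, Set.mem_preimage]
  simp [GridRank.flipX, mem_rect]
  omega

theorem Config.flipY (h : Config (rect x y a b) H k) :
    Config (rect x y a b) (H.map (flipY (2 * y + b - 1)).toEmbedding) k := by
  refine h.image (fun p q => by simp only [flipY_apply, Adj]; omega) ?_
  ext z
  rw [Equiv.image_eq_preimage_symm, Set.mem_preimage]
  simp [GridRank.flipY, mem_rect]
  omega

theorem Config.swap (h : Config (rect x y a b) H k) :
    Config (rect y x b a) (H.map (Equiv.prodComm ℤ ℤ).toEmbedding) k := by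
  refine h.image (fun p q => by simp only [Equiv.prodComm_apply, Prod.fst_swap, Prod.snd_swap, Adj]; omega) ?_
  ext z
  rw [Equiv.image_eq_preimage_symm, Set.mem_preimage]
  simp [mem_rect]
  omega

theorem Bound.swap {c : ℕ} (h : Bound (rect x y a b) c) : Bound (rect y x b a) c := by
  intro H k hc
  simpa using h _ _ hc.swap

end Symmetry

open scoped Classical in
theorem Config.restrict {R W : Set (ℤ × ℤ)} {H : Finset (ℤ × ℤ)} {k : ℕ} (h : Config R H k)
    (hW : W ⊆ R) (hp : ∀ z ∈ W, ∀ n, Adj z n → n ∉ W → ¬ Pocket R H z) :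
    Config W (H.filter (· ∈ W)) k := by
  have e : ((H.filter (· ∈ W) : Finset (ℤ × ℤ)) : Set (ℤ × ℤ)) = (H : Set (ℤ × ℤ)) ∩ W := by
    ext; simp
  refine ⟨by rw [e]; exact Set.inter_subset_right, ?_⟩
  rw [e]
  exact h.ranked.mono (outer_inter_subset hW hp)

/-- If the outer part is connected, a label can be traded for a deleted vertex. -/
theorem Config.exists_insert {R : Set (ℤ × ℤ)} {H : Finset (ℤ × ℤ)} {k : ℕ} (h : Config R H k)
    (hne : (Outer R H).Nonempty) (hconn : ∀ u ∈ Outer R H, ∀ v ∈ Outer R H, Reach (Outer R H) u v) :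
    ∃ k', k = k' + 1 ∧ ∃ H', H'.card = H.card + 1 ∧ Config R H' k' := by
  obtain ⟨k', rfl, v, hv, hr⟩ := h.ranked.exists_erase hne hconn
  classical
  refine ⟨k', rfl, insert v H, Finset.card_insert_of_notMem hv.1.2, ?_, ?_⟩
  · rw [Finset.coe_insert]
    exact Set.insert_subset hv.1.1 h.sub
  · rw [Finset.coe_insert]
    exact hr.mono outer_insert_subset

/-! ### Counting deleted vertices and peeling layers. -/

section

open scoped Classical in
/-- The number of elements of `H` in `W`. -/
noncomputable def cnt (H : Finset (ℤ × ℤ)) (W : Set (ℤ × ℤ)) : ℕ := (H.filter (· ∈ W)).card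

theorem cnt_add_card_le {H X : Finset (ℤ × ℤ)} {W W' : Set (ℤ × ℤ)} (hW : W' ⊆ W)
    (hX : ∀ z ∈ X, z ∈ H ∧ z ∈ W ∧ z ∉ W') : cnt H W' + X.card ≤ cnt H W := by
  classical
  unfold cnt
  rw [← Finset.card_union_of_disjoint]
  · refine Finset.card_le_card fun z hz => ?_
    rcases Finset.mem_union.1 hz with h | h
    · rw [Finset.mem_filter] at h ⊢
      exact ⟨h.1, hW h.2⟩
    · exact Finset.mem_filter.2 ⟨(hX z h).1, (hX z h).2.1⟩
  · rw [Finset.disjoint_left]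
    intro z h1 h2
    exact (hX z h2).2.2 (Finset.mem_filter.1 h1).2

theorem cnt_add_one_le {H : Finset (ℤ × ℤ)} {W W' : Set (ℤ × ℤ)} {z : ℤ × ℤ} (hz : z ∈ H)
    (hW : W' ⊆ W) (h : z ∈ W ∧ z ∉ W') : cnt H W' + 1 ≤ cnt H W := by
  simpa using cnt_add_card_le (X := {z}) hW (by simpa using ⟨hz, h⟩)

theorem cnt_add_two_le {H : Finset (ℤ × ℤ)} {W W' : Set (ℤ × ℤ)} {z z' : ℤ × ℤ} (hz : z ∈ H)
    (hz' : z' ∈ H) (hne : z ≠ z') (hW : W' ⊆ W) (h : z ∈ W ∧ z ∉ W') (h' : z' ∈ W ∧ z' ∉ W') :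
    cnt H W' + 2 ≤ cnt H W := by
  classical
  have := cnt_add_card_le (X := {z, z'}) hW (H := H) (by
    intro u hu
    rcases Finset.mem_insert.1 hu with rfl | hu
    · exact ⟨hz, h⟩
    · rw [Finset.mem_singleton.1 hu]; exact ⟨hz', h'⟩)
  rwa [Finset.card_pair hne] at this

theorem cnt_self {R : Set (ℤ × ℤ)} {H : Finset (ℤ × ℤ)} (h : (H : Set (ℤ × ℤ)) ⊆ R) :
    cnt H R = H.card := by
  classical
  unfold cnt
  rw [Finset.filter_true_of_mem fun z hz => h hz]

theorem Config.le_cnt {R W : Set (ℤ × ℤ)} {H : Finset (ℤ × ℤ)} {k c : ℕ} (h : Config R H k)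
    (hB : Bound W c) (hW : W ⊆ R) (hp : ∀ z ∈ W, ∀ n, Adj z n → n ∉ W → ¬ Pocket R H z) :
    c ≤ cnt H W + k :=
  hB _ _ (h.restrict hW hp)

theorem rect_subset {x y x' y' : ℤ} {a b a' b' : ℕ} (h1 : x ≤ x') (h2 : x' + a' ≤ x + a)
    (h3 : y ≤ y') (h4 : y' + b' ≤ y + b) : rect x' y' a' b' ⊆ rect x y a b := by
  intro z hz
  rw [mem_rect] at *
  omega

variable {x y : ℤ} {a b : ℕ} {H : Finset (ℤ × ℤ)} {k : ℕ}

/-- Peeling a window at the left wall. -/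
theorem Config.left_window (h : Config (rect x y a b) H k) (n : ℕ) : ∀ (w P : ℕ) (y' : ℤ),
    w + P = n → w ≤ a → y ≤ y' → y' + P ≤ y + b →
    (∀ w' P' y', w' ≤ w → P' ≤ P → Bound (rect x y' w' P') (min P' (2 * w'))) →
    min P (2 * w) ≤ cnt H (rect x y' w P) + k := by
  induction n with
  | zero => intro w P y' h0; omega
  | succ n ih =>
    intro w P y' hn hw hy hP hD
    rcases Nat.eq_zero_or_pos w with rfl | hw0
    · simp
    rcases Nat.eq_zero_or_pos P with rfl | hP0
    · simp
    -- The window shares its left wall with the rectangle, so the element of `H` to the left of a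
    -- pocket vertex lies in the window. Dropping this row costs at most one in `P`.
    by_cases h1 : ∃ z ∈ rect x y' w P, z.2 = y' ∧ Pocket (rect x y a b) H z
    · obtain ⟨z, hz, hzy, hp⟩ := h1
      obtain ⟨t, ht, htH, -⟩ := hp.exists_left
      have h2 := h.sub htH
      have h3 := ih w (P - 1) (y' + 1) (by omega) hw (by omega) (by omega) fun w' P' y' h1 h2 =>
        hD w' P' y' h1 (by omega)
      rw [mem_rect] at h2 hz
      have h4 := cnt_add_one_le (W' := rect x (y' + 1) w (P - 1)) (W := rect x y' w P) htH
        (rect_subset (by omega) (by omega) (by omega) (by omega))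
        (by rw [mem_rect, mem_rect]; dsimp only at *; omega)
      omega
    by_cases h2 : ∃ z ∈ rect x y' w P, z.2 = y' + P - 1 ∧ Pocket (rect x y a b) H z
    · obtain ⟨z, hz, hzy, hp⟩ := h2
      obtain ⟨t, ht, htH, -⟩ := hp.exists_left
      have h2 := h.sub htH
      have h3 := ih w (P - 1) y' (by omega) hw (by omega) (by omega) fun w' P' y' h1 h2 =>
        hD w' P' y' h1 (by omega)
      rw [mem_rect] at h2 hz
      have h4 := cnt_add_one_le (W' := rect x y' w (P - 1)) (W := rect x y' w P) htH
        (rect_subset (by omega) (by omega) (by omega) (by omega))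
        (by rw [mem_rect, mem_rect]; dsimp only at *; omega)
      omega
    -- The end rows are now free of pocket vertices, so the vertical runs hit `H` inside the window.
    -- These two elements pay for the loss of two in `2 * w`.
    by_cases h3 : ∃ z ∈ rect x y' w P, z.1 = x + w - 1 ∧ Pocket (rect x y a b) H z
    · obtain ⟨z, hz, hzx, hp⟩ := h3
      rw [mem_rect] at hz
      obtain ⟨t, ht, htH, htp⟩ := hp.exists_above
      obtain ⟨s, hs, hsH, hsp⟩ := hp.exists_below
      have ht' : t < y' + P := by
        by_contra hc
        exact h2 ⟨(z.1, y' + P - 1), by rw [mem_rect]; dsimp only; omega, rfl,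
          htp _ (by omega) (by omega)⟩
      have hs' : y' ≤ s := by
        by_contra hc
        exact h1 ⟨(z.1, y'), by rw [mem_rect]; dsimp only; omega, rfl, hsp _ (by omega) (by omega)⟩
      have h3 := ih (w - 1) P y'
      have h5 := cnt_add_two_le (W' := rect x y' (w - 1) P) (W := rect x y' w P) htH hsH
        (by rw [Ne, Prod.mk.injEq]; omega)
        (rect_subset (by omega) (by omega) (by omega) (by omega))
        (by rw [mem_rect, mem_rect]; dsimp only at *; omega)
        (by rw [mem_rect, mem_rect]; dsimp only at *; omega)
      have h6 := h3 (by omega) (by omega) hy hP fun w' P' y' h1 h2 =>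
        hD w' P' y' (by omega) h2
      omega
    refine h.le_cnt (hD w P y' le_rfl le_rfl)
      (rect_subset (by omega) (by omega) (by omega) (by omega)) fun z hz n hn hnW hp => ?_
    rcases side_of_adj hz hn hnW with h | h | h | h
    · exact not_pocket_of_side (.inl h) hp
    · exact h3 ⟨z, hz, h, hp⟩
    · exact h1 ⟨z, hz, h, hp⟩
    · exact h2 ⟨z, hz, h, hp⟩

/-- Peeling columns from the left. -/
theorem Config.peel_columns (h : Config (rect x y a b) H k)
    (hD : ∀ a' < a, ∀ x, Bound (rect x y a' b) (min a' (2 * b))) (n : ℕ) :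
    ∀ l, 1 ≤ l → l + n = a → min a (2 * b) ≤ l + cnt H (rect (x + l) y n b) + k := by
  induction n with
  | zero => intro l _ hl; omega
  | succ n ih =>
    intro l hl1 hl
    by_cases h1 : ∃ z, z.1 = x + l ∧ Pocket (rect x y a b) H z
    · obtain ⟨z, hz, hp⟩ := h1
      obtain ⟨t, -, htH, -⟩ := hp.exists_above
      have h2 := h.sub htH
      rw [mem_rect] at h2
      have h3 := ih (l + 1) (by omega) (by omega)
      have h4 := cnt_add_one_le (W' := rect (x + (l + 1 : ℕ)) y n b)
        (W := rect (x + l) y (n + 1) b) htH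
        (rect_subset (by omega) (by push_cast; omega) (by omega) (by omega))
        (by rw [mem_rect, mem_rect]; dsimp only at *; push_cast; omega)
      omega
    · have := h.le_cnt (hD (n + 1) (by omega) (x + l))
        (rect_subset (by omega) (by omega) (by omega) (by omega)) fun z hz n hn hnW hp => by
        rcases side_of_adj hz hn hnW with h | h | h | h
        · exact h1 ⟨z, h, hp⟩
        · exact not_pocket_of_side (.inr (.inl (by omega))) hp
        · exact not_pocket_of_side (.inr (.inr (.inl h))) hp
        · exact not_pocket_of_side (.inr (.inr (.inr h))) hp
      omega

/-- The given element of `H` pays for the first column; every later peeled column pays for itself.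
-/
theorem Config.bound_of_mem_left (h : Config (rect x y a b) H k)
    (hD : ∀ a' < a, ∀ x, Bound (rect x y a' b) (min a' (2 * b)))
    (hH : ∃ z ∈ H, z.1 = x) : min a (2 * b) ≤ H.card + k := by
  obtain ⟨z, hz, hzx⟩ := hH
  have h1 := h.sub hz
  rw [mem_rect] at h1
  have h2 := h.peel_columns hD (a - 1) 1 le_rfl (by omega)
  have h4 := cnt_add_one_le (W' := rect (x + (1 : ℕ)) y (a - 1) b) (W := rect x y a b) hz
    (rect_subset (by omega) (by push_cast; omega) (by omega) (by omega))
    (by rw [mem_rect, mem_rect]; push_cast; omega)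
  rw [cnt_self h.sub] at h4
  omega

/-- Peeling rows from the bottom. -/
theorem Config.peel_rows (h : Config (rect x y a b) H k)
    (hD : ∀ b' < b, ∀ y, Bound (rect x y a b') (min a (2 * b'))) (n : ℕ) :
    ∀ l, 1 ≤ l → l + n = b → min a (2 * b) ≤ 2 * l + cnt H (rect x (y + l) a n) + k := by
  induction n with
  | zero => intro l _ hl; omega
  | succ n ih =>
    intro l hl1 hl
    by_cases h1 : ∃ z, z.2 = y + l ∧ Pocket (rect x y a b) H z
    · obtain ⟨z, hz, hp⟩ := h1
      obtain ⟨t, ht, htH, -⟩ := hp.exists_right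
      obtain ⟨s, hs, hsH, -⟩ := hp.exists_left
      have h2 := h.sub htH
      have h2' := h.sub hsH
      rw [mem_rect] at h2 h2'
      have h3 := ih (l + 1) (by omega) (by omega)
      have h4 := cnt_add_two_le (W' := rect x (y + (l + 1 : ℕ)) a n)
        (W := rect x (y + l) a (n + 1)) htH hsH (by rw [Ne, Prod.mk.injEq]; omega)
        (rect_subset (by omega) (by omega) (by omega) (by push_cast; omega))
        (by rw [mem_rect, mem_rect]; dsimp only at *; push_cast; omega)
        (by rw [mem_rect, mem_rect]; dsimp only at *; push_cast; omega)
      omega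
    · have := h.le_cnt (hD (n + 1) (by omega) (y + l))
        (rect_subset (by omega) (by omega) (by omega) (by omega)) fun z hz n hn hnW hp => by
        rcases side_of_adj hz hn hnW with h | h | h | h
        · exact not_pocket_of_side (.inl h) hp
        · exact not_pocket_of_side (.inr (.inl h)) hp
        · exact h1 ⟨z, h, hp⟩
        · exact not_pocket_of_side (.inr (.inr (.inr (by omega)))) hp
      omega

/-- Dropping a row can cost two in `2 * b`, hence two elements of `H` are needed to start. -/
theorem Config.bound_of_mem_bottom (h : Config (rect x y a b) H k)
    (hD : ∀ b' < b, ∀ y, Bound (rect x y a b') (min a (2 * b')))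
    (hH : ∃ z ∈ H, ∃ z' ∈ H, z ≠ z' ∧ z.2 = y ∧ z'.2 = y) : min a (2 * b) ≤ H.card + k := by
  obtain ⟨z, hz, z', hz', hne, hzy, hzy'⟩ := hH
  have h1 := h.sub hz
  have h1' := h.sub hz'
  rw [mem_rect] at h1 h1'
  have h2 := h.peel_rows hD (b - 1) 1 le_rfl (by omega)
  have h4 := cnt_add_two_le (W' := rect x (y + (1 : ℕ)) a (b - 1)) (W := rect x y a b) hz hz' hne
    (rect_subset (by omega) (by omega) (by omega) (by push_cast; omega))
    (by rw [mem_rect, mem_rect]; push_cast; omega)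
    (by rw [mem_rect, mem_rect]; push_cast; omega)
  rw [cnt_self h.sub] at h4
  omega

/-- Peeling a square from a corner. -/
theorem Config.peel_corner {m : ℕ} (h : Config (rect x y m m) H k)
    (hS : ∀ m' < m, ∀ x y, Bound (rect x y m' m') ((5 * m' - 2) / 3)) (n : ℕ) :
    ∀ l, 1 ≤ l → l + n = m → 5 * n ≤ 3 * (cnt H (rect (x + l) (y + l) n n) + k) + 4 := by
  -- The inequality is `(5 * n - 2) / 3 ≤ cnt + k` without the rounding. An L-shaped layer yields
  -- two elements of `H`, that is 6 on the right against 5 on the left.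
  induction n with
  | zero => intro l _ hl; omega
  | succ n ih =>
    intro l hl1 hl
    have key : ∀ z ∈ H, ∀ z' ∈ H, z ≠ z' →
        (z.1 = x + l ∧ y + l ≤ z.2 ∨ z.2 = y + l ∧ x + l ≤ z.1) →
        (z'.1 = x + l ∧ y + l ≤ z'.2 ∨ z'.2 = y + l ∧ x + l ≤ z'.1) →
        5 * (n + 1) ≤ 3 * (cnt H (rect (x + l) (y + l) (n + 1) (n + 1)) + k) + 4 := by
      intro z hz z' hz' hne h1 h1'
      have h2 := h.sub hz
      have h2' := h.sub hz'
      rw [mem_rect] at h2 h2'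
      have h3 := ih (l + 1) (by omega) (by omega)
      have h4 := cnt_add_two_le (W' := rect (x + (l + 1 : ℕ)) (y + (l + 1 : ℕ)) n n)
        (W := rect (x + l) (y + l) (n + 1) (n + 1)) hz hz' hne
        (rect_subset (by omega) (by push_cast; omega) (by omega) (by push_cast; omega))
        (by rw [mem_rect, mem_rect]; push_cast; omega)
        (by rw [mem_rect, mem_rect]; push_cast; omega)
      omega
    by_cases h1 : ∃ z, z.1 = x + l ∧ y + l ≤ z.2 ∧ Pocket (rect x y m m) H z
    · obtain ⟨z, hz, hzy, hp⟩ := h1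
      obtain ⟨t, ht, htH, -⟩ := hp.exists_above
      obtain ⟨s, hs, hsH, hsp⟩ := hp.exists_below
      -- If the downward run leaves the L-shaped layer, it passes through its corner, which is thus
      -- a pocket vertex; the run to the right from there gives the second element.
      by_cases hs' : y + l ≤ s
      · exact key _ htH _ hsH (by rw [Ne, Prod.mk.injEq]; omega) (by dsimp only; omega)
          (by dsimp only; omega)
      · obtain ⟨r, hr, hrH, -⟩ := (hsp (y + l) (by omega) hzy).exists_right
        dsimp only at hr hrH
        exact key _ htH _ hrH (by rw [Ne, Prod.mk.injEq]; omega) (by dsimp only; omega)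
          (by dsimp only; omega)
    by_cases h2 : ∃ z, z.2 = y + l ∧ x + l ≤ z.1 ∧ Pocket (rect x y m m) H z
    · obtain ⟨z, hz, hzy, hp⟩ := h2
      obtain ⟨t, ht, htH, -⟩ := hp.exists_right
      obtain ⟨s, hs, hsH, hsp⟩ := hp.exists_left
      by_cases hs' : x + l ≤ s
      · exact key _ htH _ hsH (by rw [Ne, Prod.mk.injEq]; omega) (by dsimp only; omega)
          (by dsimp only; omega)
      · obtain ⟨r, hr, hrH, -⟩ := (hsp (x + l) (by omega) hzy).exists_above
        dsimp only at hr hrH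
        exact key _ htH _ hrH (by rw [Ne, Prod.mk.injEq]; omega) (by dsimp only; omega)
          (by dsimp only; omega)
    · have := h.le_cnt (hS (n + 1) (by omega) (x + l) (y + l))
        (rect_subset (by omega) (by omega) (by omega) (by omega)) fun z hz n hn hnW hp => by
        have hz' := hz
        rw [mem_rect] at hz'
        rcases side_of_adj hz hn hnW with h | h | h | h
        · exact h1 ⟨z, h, by omega, hp⟩
        · exact not_pocket_of_side (.inr (.inl (by omega))) hp
        · exact h2 ⟨z, h, by omega, hp⟩
        · exact not_pocket_of_side (.inr (.inr (.inr (by omega)))) hp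
      omega

theorem Config.bound_of_mem_corner {m : ℕ} (h : Config (rect x y m m) H k)
    (hS : ∀ m' < m, ∀ x y, Bound (rect x y m' m') ((5 * m' - 2) / 3))
    (hH : ∃ z ∈ H, ∃ z' ∈ H, z ≠ z' ∧ (z.1 = x ∨ z.2 = y) ∧ (z'.1 = x ∨ z'.2 = y)) :
    (5 * m - 2) / 3 ≤ H.card + k := by
  obtain ⟨z, hz, z', hz', hne, hz1, hz2⟩ := hH
  have h1 := h.sub hz
  have h1' := h.sub hz'
  rw [mem_rect] at h1 h1'
  have h2 := h.peel_corner hS (m - 1) 1 le_rfl (by omega)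
  have h4 := cnt_add_two_le (W' := rect (x + (1 : ℕ)) (y + (1 : ℕ)) (m - 1) (m - 1))
    (W := rect x y m m) hz hz' hne
    (rect_subset (by omega) (by push_cast; omega) (by omega) (by push_cast; omega))
    (by rw [mem_rect, mem_rect]; push_cast; omega)
    (by rw [mem_rect, mem_rect]; push_cast; omega)
  rw [cnt_self h.sub] at h4
  omega

end

/-! ### Connectedness of the outer part. -/

section

theorem Reach.outer {R H : Set (ℤ × ℤ)} {u v : ℤ × ℤ} (h : Reach (R \ H) u v)
    (hu : u ∈ Outer R H) : Reach (Outer R H) u v ∧ v ∈ Outer R H := by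
  induction h with
  | refl => exact ⟨.refl, hu⟩
  | tail _ h ih =>
    have h1 := mem_outer_of_reach h.2.2 (.single ⟨h.1.symm, h.2.2, h.2.1⟩) ih.2
    exact ⟨ih.1.tail ⟨h.1, ih.2, h1⟩, h1⟩

theorem outer_connected {R H : Set (ℤ × ℤ)} (c : ℤ × ℤ)
    (hc : ∀ w ∈ R \ H, ∀ n, Adj w n → n ∉ R → Reach (R \ H) w c) :
    ∀ u ∈ Outer R H, ∀ v ∈ Outer R H, Reach (Outer R H) u v := by
  have h : ∀ u ∈ Outer R H, Reach (R \ H) u c := by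
    rintro u ⟨_, w, n, h1, h2, h3, h4⟩
    exact h4.trans (hc w h3 n h1 h2)
  exact fun u hu v hv => (((h u hu).trans (h v hv).symm).outer hu).1

variable {x y : ℤ} {a b : ℕ} {H : Finset (ℤ × ℤ)} {k : ℕ}

/-- A single element of `H` in a row cannot block both directions. -/
theorem reach_side_of_row {z : ℤ × ℤ} (hz : z ∈ rect x y a b)
    (hzH : z ∉ H) (hrow : ∀ p ∈ H, ∀ q ∈ H, p.2 = z.2 → q.2 = z.2 → p = q) :
    Reach (rect x y a b \ H) z (x, z.2) ∨ Reach (rect x y a b \ H) z (x + a - 1, z.2) := by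
  rw [mem_rect] at hz
  by_cases h1 : ∃ p ∈ H, p.2 = z.2 ∧ p.1 < z.1
  · obtain ⟨p, hp, hp2, hp1⟩ := h1
    right
    refine reach_row' (y := z.2) (x₁ := z.1) (by omega) fun x' h2 h3 => ⟨?_, fun hx => ?_⟩
    · rw [mem_rect]; dsimp only; omega
    · have := hrow _ hp _ hx hp2 rfl
      rw [this] at hp1
      dsimp only at hp1
      omega
  · left
    refine Reach.symm (reach_row' (y := z.2) (x₂ := z.1) (by omega) fun x' h2 h3 =>
      ⟨?_, fun hx => ?_⟩)
    · rw [mem_rect]; dsimp only; omega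
    · rcases h3.lt_or_eq with h3 | rfl
      · exact h1 ⟨_, hx, rfl, h3⟩
      · exact hzH hx

/-- If the left and right sides miss `H`, and the other two sides have at most one vertex of `H`
each, then a label can be traded for a deleted vertex unless `H` separates left from right. -/
theorem Config.exists_insert_or_separated (h : Config (rect x y a b) H k) (ha : 1 ≤ a)
    (hL : ∀ z ∈ H, z.1 ≠ x) (hR : ∀ z ∈ H, z.1 ≠ x + a - 1)
    (hT : ∀ p ∈ H, ∀ q ∈ H, p.2 = y → q.2 = y → p = q)
    (hB : ∀ p ∈ H, ∀ q ∈ H, p.2 = y + b - 1 → q.2 = y + b - 1 → p = q) :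
    (∃ k', k = k' + 1 ∧ ∃ H', H'.card = H.card + 1 ∧ Config (rect x y a b) H' k') ∨
    ∀ p ∈ rect x y a b, ∀ q ∈ rect x y a b, p.1 = x → q.1 = x + a - 1 →
      ¬ Reach (rect x y a b \ H) p q := by
  by_cases hs : ∃ p ∈ rect x y a b, ∃ q ∈ rect x y a b, p.1 = x ∧ q.1 = x + a - 1 ∧
      Reach (rect x y a b \ H) p q
  swap
  · right
    intro p hp q hq h1 h2 h3
    exact hs ⟨p, hp, q, hq, h1, h2, h3⟩
  left
  obtain ⟨p, hp, q, hq, hp1, hq1, hpq⟩ := hs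
  have hleft : ∀ y₁ y₂, y ≤ y₁ → y₁ < y + b → y ≤ y₂ → y₂ < y + b →
      Reach (rect x y a b \ H) (x, y₁) (x, y₂) := by
    have key : ∀ y₁ y₂, y ≤ y₁ → y₁ ≤ y₂ → y₂ < y + b →
        Reach (rect x y a b \ H) (x, y₁) (x, y₂) := fun y₁ y₂ h1 h2 h3 =>
      reach_col' h2 fun y' h4 h5 => ⟨by rw [mem_rect]; dsimp only; omega, fun hy => hL _ hy rfl⟩
    intro y₁ y₂ h1 h2 h3 h4
    rcases le_total y₁ y₂ with h5 | h5
    · exact key _ _ h1 h5 h4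
    · exact (key _ _ h3 h5 h2).symm
  have hright : ∀ y₁ y₂, y ≤ y₁ → y₁ < y + b → y ≤ y₂ → y₂ < y + b →
      Reach (rect x y a b \ H) (x + a - 1, y₁) (x + a - 1, y₂) := by
    have key : ∀ y₁ y₂, y ≤ y₁ → y₁ ≤ y₂ → y₂ < y + b →
        Reach (rect x y a b \ H) (x + a - 1, y₁) (x + a - 1, y₂) := fun y₁ y₂ h1 h2 h3 =>
      reach_col' h2 fun y' h4 h5 => ⟨by rw [mem_rect]; dsimp only; omega, fun hy => hR _ hy rfl⟩
    intro y₁ y₂ h1 h2 h3 h4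
    rcases le_total y₁ y₂ with h5 | h5
    · exact key _ _ h1 h5 h4
    · exact (key _ _ h3 h5 h2).symm
  rw [mem_rect] at hp hq
  have hp' : p = (x, p.2) := Prod.ext hp1 rfl
  have hq' : q = (x + a - 1, q.2) := Prod.ext hq1 rfl
  rw [hp', hq'] at hpq
  have hL' : ∀ y', y ≤ y' → y' < y + b → Reach (rect x y a b \ H) (x, y') (x, p.2) :=
    fun y' h1 h2 => hleft _ _ h1 h2 hp.2.1 hp.2.2
  have hR' : ∀ y', y ≤ y' → y' < y + b → Reach (rect x y a b \ H) (x + a - 1, y') (x, p.2) :=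
    fun y' h1 h2 => (hright _ _ h1 h2 hq.2.1 hq.2.2).trans hpq.symm
  refine h.exists_insert ⟨(x, y), mem_outer_of_adj (n := (x - 1, y)) ⟨?_, fun h => hL _ h rfl⟩ ?_ ?_⟩
    (outer_connected (x, p.2) fun w hw n hn hnR => ?_)
  · rw [mem_rect]; dsimp only; omega
  · simp [Adj]
  · rw [mem_rect]; dsimp only; omega
  · have hw1 := hw.1
    rw [mem_rect] at hw1
    have hrow : (∀ p ∈ H, ∀ q ∈ H, p.2 = w.2 → q.2 = w.2 → p = q) →
        Reach (rect x y a b \ H) w (x, p.2) := fun hr => by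
      rcases reach_side_of_row hw.1 hw.2 hr with h | h
      · exact h.trans (hL' _ hw1.2.1 hw1.2.2)
      · exact h.trans (hR' _ hw1.2.1 hw1.2.2)
    rcases side_of_adj hw.1 hn hnR with h | h | h | h
    · rw [show w = (x, w.2) from Prod.ext h rfl]
      exact hL' _ hw1.2.1 hw1.2.2
    · rw [show w = (x + a - 1, w.2) from Prod.ext h rfl]
      exact hR' _ hw1.2.1 hw1.2.2
    · exact hrow (h ▸ hT)
    · exact hrow (h ▸ hB)

/-- If `H` meets the border of a square in one corner at most, then a label can be traded for a
deleted vertex. -/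
theorem Config.exists_insert_of_corner {m : ℕ} (h : Config (rect x y m m) H k) (hm : 1 ≤ m)
    (hR : ∀ z ∈ H, z.1 ≠ x + m - 1) (hT : ∀ z ∈ H, z.2 ≠ y + m - 1)
    (hL : ∀ z ∈ H, z.1 = x → z.2 = y) (hB : ∀ z ∈ H, z.2 = y → z.1 = x) :
    ∃ k', k = k' + 1 ∧ ∃ H', H'.card = H.card + 1 ∧ Config (rect x y m m) H' k' := by
  have hcol : ∀ y', y ≤ y' → y' < y + m →
      Reach (rect x y m m \ H) (x + m - 1, y') (x + m - 1, y + m - 1) := fun y' h1 h2 =>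
    reach_col' (by omega) fun i h3 h4 =>
      ⟨by rw [mem_rect]; dsimp only; omega, fun hi => hR _ hi rfl⟩
  have hrow : ∀ x', x ≤ x' → x' < x + m →
      Reach (rect x y m m \ H) (x', y + m - 1) (x + m - 1, y + m - 1) := fun x' h1 h2 =>
    reach_row' (by omega) fun i h3 h4 =>
      ⟨by rw [mem_rect]; dsimp only; omega, fun hi => hT _ hi rfl⟩
  refine h.exists_insert ⟨(x + m - 1, y + m - 1), mem_outer_of_adj (n := (x + m, y + m - 1))
    ⟨?_, fun h => hR _ h rfl⟩ ?_ ?_⟩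
    (outer_connected (x + m - 1, y + m - 1) fun w hw n hn hnR => ?_)
  · rw [mem_rect]; dsimp only; omega
  · simp [Adj]
  · rw [mem_rect]; dsimp only; omega
  · have hw1 := hw.1
    rw [mem_rect] at hw1
    rcases side_of_adj hw.1 hn hnR with h | h | h | h
    -- On the left side only the bottom corner can lie in `H`, so the way up is free.
    · refine Reach.trans (v := (w.1, y + m - 1)) (reach_col' (x := w.1) (y₁ := w.2) (by omega)
        fun i h3 h4 => ⟨by rw [mem_rect]; dsimp only; omega, fun hi => hw.2 ?_⟩)
        (hrow _ hw1.1.1 hw1.1.2)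
      have := hL _ hi h
      dsimp only at this
      rwa [show i = w.2 by omega] at hi
    · have := hcol _ hw1.2.1 hw1.2.2
      rwa [← h] at this ⊢
    · refine Reach.trans (v := (x + m - 1, w.2)) (reach_row' (y := w.2) (x₁ := w.1) (by omega)
        fun i h3 h4 => ⟨by rw [mem_rect]; dsimp only; omega, fun hi => hw.2 ?_⟩)
        (hcol _ hw1.2.1 hw1.2.2)
      have := hB _ hi h
      dsimp only at this
      rwa [show i = w.1 by omega] at hi
    · have := hrow _ hw1.1.1 hw1.1.2
      rwa [← h] at this ⊢

end

/-! ### Planar duality modulo 2. -/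

/-- King moves between the elements of `H`. -/
def kingGraph (H : Finset (ℤ × ℤ)) : SimpleGraph (ℤ × ℤ) where
  Adj p q := p ≠ q ∧ (p ∈ H ∧ q ∈ H) ∧ (p.1 ≤ q.1 + 1 ∧ q.1 ≤ p.1 + 1) ∧
    p.2 ≤ q.2 + 1 ∧ q.2 ≤ p.2 + 1
  symm := ⟨fun _ _ h => ⟨h.1.symm, ⟨h.2.1.2, h.2.1.1⟩, ⟨h.2.2.1.2, h.2.2.1.1⟩, h.2.2.2.2, h.2.2.2.1⟩⟩
  loopless := ⟨fun _ h => h.1 rfl⟩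

theorem kingGraph_mem {H : Finset (ℤ × ℤ)} {u v : ℤ × ℤ} (h : (kingGraph H).Reachable u v)
    (hu : u ∈ H) : v ∈ H := by
  obtain ⟨w⟩ := h
  induction w with
  | nil => exact hu
  | cons h _ ih => exact ih h.2.1.2

/-- A path of king moves between the elements of `H`. -/
structure KingPath (H : Finset (ℤ × ℤ)) (n : ℕ) (p : ℕ → ℤ × ℤ) : Prop where
  mem : ∀ i ≤ n, p i ∈ H
  inj : Set.InjOn p {i | i ≤ n}
  fst : ∀ i < n, (p i).1 ≤ (p (i + 1)).1 + 1 ∧ (p (i + 1)).1 ≤ (p i).1 + 1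
  snd : ∀ i < n, (p i).2 ≤ (p (i + 1)).2 + 1 ∧ (p (i + 1)).2 ≤ (p i).2 + 1

theorem exists_kingPath {H : Finset (ℤ × ℤ)} {u v : ℤ × ℤ} (h : (kingGraph H).Reachable u v)
    (hu : u ∈ H) : ∃ n p, KingPath H n p ∧ p 0 = u ∧ p n = v := by
  classical
  obtain ⟨w⟩ := h
  have hw := w.bypass_isPath
  have hadj : ∀ i < w.bypass.length, (kingGraph H).Adj (w.bypass.getVert i)
    (w.bypass.getVert (i + 1)) := fun i hi => w.bypass.adj_getVert_succ hi
  refine ⟨w.bypass.length, w.bypass.getVert, ⟨fun i hi => ?_, hw.getVert_injOn,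
    fun i hi => (hadj i hi).2.2.1, fun i hi => (hadj i hi).2.2.2⟩, by simp, by simp⟩
  exact kingGraph_mem ⟨w.bypass.take i⟩ hu

open scoped Classical in
/-- Whether one of `p`, `q` lies in `A` and the other in `K`. -/
noncomputable def edgeParity (A K : Set (ℤ × ℤ)) (p q : ℤ × ℤ) : ZMod 2 :=
  (if p ∈ A then 1 else 0) * (if q ∈ K then 1 else 0) +
    (if p ∈ K then 1 else 0) * (if q ∈ A then 1 else 0)

open scoped Classical in
theorem edgeParity_eq_sub {A K : Set (ℤ × ℤ)} {p q : ℤ × ℤ} (hAK : ∀ z ∈ A, z ∉ K)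
    (hpq : p ∈ A → q ∉ A → q ∈ K) (hqp : q ∈ A → p ∉ A → p ∈ K) :
    edgeParity A K p q = (if q ∈ A then 1 else 0) - (if p ∈ A then 1 else 0) := by
  have h3 : -(1 : ZMod 2) = 1 := by decide
  have h1 := hAK p
  have h2 := hAK q
  unfold edgeParity
  by_cases hp : p ∈ A <;> by_cases hq : q ∈ A <;> simp_all

theorem edgeParity_eq_zero {A K : Set (ℤ × ℤ)} {p q : ℤ × ℤ} (hp : p ∉ K) (hq : q ∉ K) :
    edgeParity A K p q = 0 := by
  simp [edgeParity, hp, hq]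

/-- In a 2 × 2 block any two vertices are a king move apart. If the block meets `K`, all its
vertices of `H` lie in `K`, so each edge leaving `A` ends in `K`, and the changes of membership in
`A` cancel around the square. Otherwise all terms vanish. -/
theorem edgeParity_block {A K H : Set (ℤ × ℤ)} {p q r s : ℤ × ℤ} (hAK : ∀ z ∈ A, z ∉ K)
    (hpq : (p ∈ A → q ∉ A → q ∈ H) ∧ (q ∈ A → p ∉ A → p ∈ H))
    (hrs : (r ∈ A → s ∉ A → s ∈ H) ∧ (s ∈ A → r ∉ A → r ∈ H))
    (hpr : (p ∈ A → r ∉ A → r ∈ H) ∧ (r ∈ A → p ∉ A → p ∈ H))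
    (hqs : (q ∈ A → s ∉ A → s ∈ H) ∧ (s ∈ A → q ∉ A → q ∈ H))
    (hK : ∀ u, (u = p ∨ u = q ∨ u = r ∨ u = s) → ∀ v, (v = p ∨ v = q ∨ v = r ∨ v = s) →
      u ∈ K → v ∈ H → v ∈ K) :
    edgeParity A K p q - edgeParity A K r s = edgeParity A K q s - edgeParity A K p r := by
  classical
  by_cases h : ∃ u, (u = p ∨ u = q ∨ u = r ∨ u = s) ∧ u ∈ K
  · obtain ⟨u, hu, huK⟩ := h
    have hp := hK u hu p (by simp) huK
    have hq := hK u hu q (by simp) huK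
    have hr := hK u hu r (by simp) huK
    have hs := hK u hu s (by simp) huK
    rw [edgeParity_eq_sub hAK (fun h h' => hq (hpq.1 h h')) (fun h h' => hp (hpq.2 h h')),
      edgeParity_eq_sub hAK (fun h h' => hs (hrs.1 h h')) (fun h h' => hr (hrs.2 h h')),
      edgeParity_eq_sub hAK (fun h h' => hr (hpr.1 h h')) (fun h h' => hp (hpr.2 h h')),
      edgeParity_eq_sub hAK (fun h h' => hs (hqs.1 h h')) (fun h h' => hq (hqs.2 h h'))]
    generalize (if p ∈ A then (1 : ZMod 2) else 0) = P
    generalize (if q ∈ A then (1 : ZMod 2) else 0) = Q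
    generalize (if r ∈ A then (1 : ZMod 2) else 0) = R
    generalize (if s ∈ A then (1 : ZMod 2) else 0) = S
    revert P Q R S
    decide
  · have hn : ∀ u, (u = p ∨ u = q ∨ u = r ∨ u = s) → u ∉ K := fun u hu hK => h ⟨u, hu, hK⟩
    rw [edgeParity_eq_zero (hn p (by simp)) (hn q (by simp)),
      edgeParity_eq_zero (hn r (by simp)) (hn s (by simp)),
      edgeParity_eq_zero (hn p (by simp)) (hn r (by simp)),
      edgeParity_eq_zero (hn q (by simp)) (hn s (by simp))]

/-- If `H` separates the left side of a rectangle from the right side, then it contains a path of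
king moves from the bottom row to the top row. -/
theorem exists_kingPath_of_separated {x y : ℤ} {a b : ℕ} {H : Finset (ℤ × ℤ)} (ha : 1 ≤ a)
    (hb : 1 ≤ b) (hH : (H : Set (ℤ × ℤ)) ⊆ rect x y a b)
    (hsep : ∀ p ∈ rect x y a b, ∀ q ∈ rect x y a b, p.1 = x → q.1 = x + a - 1 →
      ¬ Reach (rect x y a b \ H) p q) :
    ∃ n p, KingPath H n p ∧ (p 0).2 = y ∧ (p n).2 = y + b - 1 := by
  classical
  -- The extra column `x - 1` makes every row start in `A`, even where the left side lies in `H`.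
  set A : Set (ℤ × ℤ) := {z : ℤ × ℤ | z.1 = x - 1 ∨ (z ∈ rect x y a b \ H ∧
    ∃ p ∈ rect x y a b, p.1 = x ∧ Reach (rect x y a b \ H) p z)}
  set K : Set (ℤ × ℤ) := {v | ∃ u ∈ H, u.2 = y ∧ (kingGraph H).Reachable u v} 
  have hKH : K ⊆ H := fun v ⟨u, hu, _, h⟩ => kingGraph_mem h hu
  have hAK : ∀ z ∈ A, z ∉ K := by
    rintro z (hz | hz) hzK
    · have := hH (hKH hzK)
      rw [mem_rect] at this
      omega
    · exact hz.1.2 (hKH hzK)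
  have hAadj : ∀ p q, Adj p q → x - 1 ≤ q.1 → q.1 < x + a → y ≤ q.2 → q.2 < y + b →
      p ∈ A → q ∉ A → q ∈ H := by
    intro p q hpq h1 h2 h3 h4 hp hq
    by_contra hqH
    have hqx : q.1 ≠ x - 1 := fun h => hq (.inl h)
    have hqR : q ∈ rect x y a b \ H := ⟨by rw [mem_rect]; omega, hqH⟩
    refine hq (.inr ⟨hqR, ?_⟩)
    rcases hp with hp | ⟨hpR, u, hu, hux, hup⟩
    · refine ⟨q, hqR.1, ?_, .refl⟩
      unfold Adj at hpq
      omega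
    · exact ⟨u, hu, hux, hup.tail ⟨hpq, hpR, hqR⟩⟩
  have hAR : ∀ z ∈ A, z.1 ≠ x + a - 1 := by
    rintro z (hz | ⟨hz, u, hu, hux, huz⟩) hzx
    · omega
    · exact hsep u hu z hz.1 hux hzx huz
  have hKadj : ∀ u v : ℤ × ℤ, u.1 ≤ v.1 + 1 → v.1 ≤ u.1 + 1 → u.2 ≤ v.2 + 1 → v.2 ≤ u.2 + 1 →
      u ∈ K → v ∈ H → v ∈ K := by
    rintro u v h1 h2 h3 h4 ⟨w, hw, hwy, h⟩ hv
    by_cases huv : u = v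
    · exact huv ▸ ⟨w, hw, hwy, h⟩
    · have hadj : (kingGraph H).Adj u v := ⟨huv, ⟨kingGraph_mem h hw, hv⟩, ⟨h1, h2⟩, h3, h4⟩
      exact ⟨w, hw, hwy, h.trans hadj.reachable⟩
  have hA0 : ∀ j : ℤ, (x - 1 + ((0 : ℕ) : ℤ), j) ∈ A := fun j => .inl (by simp)
  clear_value A
  -- `N j` counts the edges of row `j` between `A` and `K` modulo 2. It is the same in all rows and
  -- equals 1 in the bottom row, where every element of `H` is in `K`; so `K` reaches the top row.
  let N : ℤ → ZMod 2 := fun j =>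
    ∑ i ∈ Finset.range a, edgeParity A K (x - 1 + i, j) (x - 1 + (i + 1 : ℕ), j)
  have hstep : ∀ j, y ≤ j → j + 1 < y + b → N j = N (j + 1) := by
    intro j h1 h2
    rw [← sub_eq_zero, ← Finset.sum_sub_distrib]
    rw [Finset.sum_congr rfl fun i hi => ?_, Finset.sum_range_sub fun i : ℕ =>
      edgeParity A K (x - 1 + i, j) (x - 1 + i, j + 1)]
    · rw [edgeParity_eq_sub hAK, edgeParity_eq_sub hAK]
      · have e1 : ∀ j', (x - 1 + (a : ℤ), j') ∉ A := fun j' h => hAR _ h (by dsimp only; omega)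
        simp only [e1, hA0, if_true, if_false, sub_self]
      · exact fun _ h => absurd (hA0 _) h
      · exact fun _ h => absurd (hA0 _) h
      · exact fun h => absurd (show x - 1 + (a : ℤ) = x + a - 1 by omega) (hAR _ h)
      · exact fun h => absurd (show x - 1 + (a : ℤ) = x + a - 1 by omega) (hAR _ h)
    · rw [Finset.mem_range] at hi
      refine edgeParity_block (H := H) hAK ⟨hAadj _ _ ?_ ?_ ?_ ?_ ?_, hAadj _ _ ?_ ?_ ?_ ?_ ?_⟩
        ⟨hAadj _ _ ?_ ?_ ?_ ?_ ?_, hAadj _ _ ?_ ?_ ?_ ?_ ?_⟩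
        ⟨hAadj _ _ ?_ ?_ ?_ ?_ ?_, hAadj _ _ ?_ ?_ ?_ ?_ ?_⟩
        ⟨hAadj _ _ ?_ ?_ ?_ ?_ ?_, hAadj _ _ ?_ ?_ ?_ ?_ ?_⟩ ?_
      -- The first 40 goals are the side conditions of eight uses of `hAadj`; this one is the
      -- closure of `K` under king moves.
      case refine_41 =>
        intro u hu v hv
        apply hKadj <;> rcases hu with rfl | rfl | rfl | rfl <;>
          rcases hv with rfl | rfl | rfl | rfl <;> dsimp only <;> push_cast <;> omega
      all_goals first
        | (unfold Adj; push_cast; omega)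
        | (push_cast; omega)
  have hconst : ∀ n : ℕ, n < b → N (y + n) = N y := by
    intro n
    induction n with
    | zero => simp
    | succ n ih =>
      intro hn
      rw [← ih (by omega), Nat.cast_succ, ← add_assoc]
      exact (hstep _ (by omega) (by omega)).symm
  have hbot : N y = 1 := by
    have key : ∀ i : ℕ, i < a → edgeParity A K (x - 1 + i, y) (x - 1 + (i + 1 : ℕ), y) =
        (if (x - 1 + ((i + 1 : ℕ) : ℤ), y) ∈ A then 1 else 0) -
          (if (x - 1 + (i : ℤ), y) ∈ A then 1 else 0) := by
      intro i hi
      have hHK : ∀ z ∈ H, z.2 = y → z ∈ K := fun z hz hzy => ⟨z, hz, hzy, .refl z⟩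
      refine edgeParity_eq_sub hAK (fun h h' => hHK (_, y) (hAadj _ _ ?_ ?_ ?_ ?_ ?_ h h') rfl)
        (fun h h' => hHK (_, y) (hAadj _ _ ?_ ?_ ?_ ?_ ?_ h h') rfl)
      all_goals first
        | (unfold Adj; push_cast; omega)
        | (push_cast; omega)
    show ∑ i ∈ Finset.range a, _ = _
    rw [Finset.sum_congr rfl fun i hi => key i (Finset.mem_range.1 hi),
      Finset.sum_range_sub fun i : ℕ => if (x - 1 + (i : ℤ), y) ∈ A then (1 : ZMod 2) else 0,
      if_neg fun h => hAR _ h (by dsimp only; omega), if_pos (hA0 y)]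
    decide
  by_contra hno
  have htop : N (y + (b - 1 : ℕ)) = 0 := by
    refine Finset.sum_eq_zero fun i _ => ?_
    have : ∀ i' : ℤ, (i', y + ((b - 1 : ℕ) : ℤ)) ∉ K := by
      rintro i' ⟨u, hu, huy, h⟩
      obtain ⟨n, p, hp, hp0, hpn⟩ := exists_kingPath h hu
      exact hno ⟨n, p, hp, hp0 ▸ huy, by rw [hpn]; dsimp only; omega⟩
    exact edgeParity_eq_zero (this _) (this _)
  rw [hconst _ (by omega), hbot] at htop
  exact absurd htop (by decide)

/-! ### The bound for rectangles. -/

section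

theorem le_add_of_steps {f : ℕ → ℤ} {n : ℕ} (hf : ∀ i < n, f i ≤ f (i + 1) + 1 ∧ f (i + 1) ≤ f i + 1)
    {i j : ℕ} (hij : i ≤ j) (hj : j ≤ n) : f i ≤ f j + (j - i) ∧ f j ≤ f i + (j - i) := by
  induction j, hij using Nat.le_induction with
  | base => simp
  | succ j hij ih =>
    have h1 := hf j (by omega)
    have h2 := ih (by omega)
    push_cast
    omega

variable {x y : ℤ} {a b : ℕ} {H : Finset (ℤ × ℤ)} {k : ℕ}

/-- The window bound counts only elements of `H` inside the window, so those of `X` come on top. -/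
theorem Config.bound_of_left_free (h : Config (rect x y a b) H k) {X : Finset (ℤ × ℤ)}
    (hX : X ⊆ H) {w P : ℕ} {y' : ℤ} (hfree : ∀ z ∈ X, z ∉ rect x y' w P)
    (hw : w ≤ a) (hy : y ≤ y') (hP : y' + P ≤ y + b)
    (hD : ∀ w' P' y', w' ≤ w → P' ≤ P → Bound (rect x y' w' P') (min P' (2 * w'))) :
    min P (2 * w) + X.card ≤ H.card + k := by
  have h1 := h.left_window _ w P y' rfl hw hy hP hD
  have h2 := cnt_add_card_le (H := H) (X := X) (W := rect x y a b) (W' := rect x y' w P)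
    (rect_subset le_rfl (by omega) hy hP) fun z hz => ⟨hX hz, h.sub (hX hz), hfree z hz⟩
  rw [cnt_self h.sub] at h2
  omega

theorem Config.bound_of_right_free (h : Config (rect x y a b) H k) {X : Finset (ℤ × ℤ)}
    (hX : X ⊆ H) {w P : ℕ} {y' : ℤ} (hfree : ∀ z ∈ X, z ∉ rect (x + a - w) y' w P)
    (hw : w ≤ a) (hy : y ≤ y') (hP : y' + P ≤ y + b)
    (hD : ∀ w' P' y', w' ≤ w → P' ≤ P → Bound (rect x y' w' P') (min P' (2 * w'))) :
    min P (2 * w) + X.card ≤ H.card + k := by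
  have := h.flipX.bound_of_left_free (X := X.map (GridRank.flipX (2 * x + a - 1)).toEmbedding)
    (Finset.map_subset_map.2 hX) (w := w) (P := P) (y' := y') ?_ hw hy hP hD
  · simpa using this
  · intro z hz
    obtain ⟨u, hu, rfl⟩ := Finset.mem_map.1 hz
    have := hfree u hu
    rw [mem_rect] at this ⊢
    simp only [Equiv.coe_toEmbedding, flipX_apply]
    omega

open scoped Classical in
/-- The vertices of a path. -/
noncomputable def trace (n : ℕ) (p : ℕ → ℤ × ℤ) : Finset (ℤ × ℤ) := (Finset.range (n + 1)).image p

theorem mem_trace {n : ℕ} {p : ℕ → ℤ × ℤ} {z : ℤ × ℤ} : z ∈ trace n p ↔ ∃ i ≤ n, p i = z := by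
  simp [trace]

theorem KingPath.trace_subset {n : ℕ} {p : ℕ → ℤ × ℤ} (hp : KingPath H n p) : trace n p ⊆ H := by
  intro z hz
  obtain ⟨i, hi, rfl⟩ := mem_trace.1 hz
  exact hp.mem i hi

theorem KingPath.card_trace {n : ℕ} {p : ℕ → ℤ × ℤ} (hp : KingPath H n p) :
    (trace n p).card = n + 1 := by
  classical
  unfold trace
  rw [Finset.card_image_of_injOn, Finset.card_range]
  intro i hi j hj
  exact hp.inj (Nat.lt_succ_iff.1 (Finset.mem_range.1 hi)) (Nat.lt_succ_iff.1 (Finset.mem_range.1 hj))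

/-- The bound for a rectangle. -/
theorem bound_rect (n : ℕ) : ∀ (a b : ℕ) (x y : ℤ), a + b = n →
    Bound (rect x y a b) (min a (2 * b)) := by
  induction n using Nat.strong_induction_on with
  | _ n ihn =>
  intro a b x y hab H k
  have hDa : ∀ a' < a, ∀ x, Bound (rect x y a' b) (min a' (2 * b)) := fun a' ha' x =>
    ihn (a' + b) (by omega) a' b x y rfl
  have hDb : ∀ b' < b, ∀ y, Bound (rect x y a b') (min a (2 * b')) := fun b' hb' y =>
    ihn (a + b') (by omega) a b' x y rfl
  -- Trading a label for a deleted vertex leaves the size fixed and lowers `k`.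
  induction k using Nat.strong_induction_on generalizing H with
  | _ k ihk =>
  intro h
  rcases Nat.eq_zero_or_pos a with rfl | ha
  · simp
  rcases Nat.eq_zero_or_pos b with rfl | hb
  · simp
  by_cases hL : ∃ z ∈ H, z.1 = x
  · exact h.bound_of_mem_left hDa hL
  by_cases hR : ∃ z ∈ H, z.1 = x + a - 1
  · obtain ⟨z, hz, hzx⟩ := hR
    simpa using h.flipX.bound_of_mem_left hDa
      ⟨_, Finset.mem_map_of_mem _ hz, by simp only [Equiv.coe_toEmbedding, flipX_apply]; omega⟩
  by_cases hB : ∃ z ∈ H, ∃ z' ∈ H, z ≠ z' ∧ z.2 = y ∧ z'.2 = y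
  · exact h.bound_of_mem_bottom hDb hB
  by_cases hT : ∃ z ∈ H, ∃ z' ∈ H, z ≠ z' ∧ z.2 = y + b - 1 ∧ z'.2 = y + b - 1
  · obtain ⟨z, hz, z', hz', hne, hzy, hzy'⟩ := hT
    simpa using h.flipY.bound_of_mem_bottom hDb
      ⟨_, Finset.mem_map_of_mem _ hz, _, Finset.mem_map_of_mem _ hz',
        fun he => hne ((flipY _).injective he), by
        simp only [Equiv.coe_toEmbedding, flipY_apply]; omega⟩
  push Not at hL hR hB hT
  rcases h.exists_insert_or_separated ha hL hR
    (fun p hp q hq h1 h2 => by_contra fun hne => hB p hp q hq hne h1 h2)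
    (fun p hp q hq h1 h2 => by_contra fun hne => hT p hp q hq hne h1 h2) with
    ⟨k', rfl, H', hH', hc⟩ | hsep
  · have := ihk k' (by omega) H' hc
    omega
  obtain ⟨l, p, hp, hp0, hpl⟩ := exists_kingPath_of_separated ha hb h.sub hsep
  have hXH := Finset.card_le_card hp.trace_subset
  have hX := hp.card_trace
  have hbl := le_add_of_steps hp.snd (Nat.zero_le l) le_rfl
  rcases le_or_gt a (l + 1) with hal | hal
  · omega
  have hD : ∀ w' P' y', w' ≤ (a - l) / 2 → P' ≤ b →
      Bound (rect x y' w' P') (min P' (2 * w')) := fun w' P' y' h1 h2 =>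
    (ihn (P' + w') (by omega) P' w' y' x rfl).swap
  -- The path has `l` steps, and a point in the left window is more than `l` columns from one in the
  -- right window. So one of the two is free and adds `min b (2 * ((a - l) / 2))` to the `l + 1 ≥ b`
  -- vertices of the path.
  by_cases hfree : ∀ z ∈ trace l p, z ∉ rect x y ((a - l) / 2) b
  · have := h.bound_of_left_free hp.trace_subset hfree (by omega) le_rfl le_rfl hD
    omega
  by_cases hfree' : ∀ z ∈ trace l p, z ∉ rect (x + a - ((a - l) / 2 : ℕ)) y ((a - l) / 2) b
  · have := h.bound_of_right_free hp.trace_subset hfree' (by omega) le_rfl le_rfl hD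
    omega
  push Not at hfree hfree'
  obtain ⟨z, hz, hzr⟩ := hfree
  obtain ⟨z', hz', hzr'⟩ := hfree'
  obtain ⟨i, hi, rfl⟩ := mem_trace.1 hz
  obtain ⟨j, hj, rfl⟩ := mem_trace.1 hz'
  rw [mem_rect] at hzr hzr'
  rcases le_total i j with hij | hij
  · have := le_add_of_steps hp.fst hij hj
    omega
  · have := le_add_of_steps hp.fst hij hi
    omega

end

/-! ### Walks that visit all windows at both walls. -/

section Windows

variable {f : ℕ → ℤ} {n m q : ℕ} {T B : ℕ → Prop}

/-- Take the highest `T`-visit before time `t` and the lowest one after it. Their heights differ by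
at most `2q` upwards, or a window between them would be missed. The two crossings take `m - 2q + 1`
steps each, and the climbs before and after add `m - 1 - 2q`. -/
theorem le_of_visit_between (hf : ∀ i < n, f i ≤ f (i + 1) + 1 ∧ f (i + 1) ≤ f i + 1)
    (h0 : f 0 = 0) (hn : f n = m - 1) (hpos : ∀ i ≤ n, 0 ≤ f i ∧ f i ≤ m - 1) (hq : 2 * q ≤ m)
    (hsep : ∀ i j, i ≤ n → j ≤ n → T i → B j → (m : ℤ) - 2 * q + 1 ≤ |(i : ℤ) - j|)
    (hT : ∀ j : ℕ, j + 2 * q ≤ m → ∃ i ≤ n, T i ∧ j ≤ f i ∧ f i < j + 2 * q)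
    {s t u : ℕ} (hst : s < t) (htu : t < u) (hu : u ≤ n) (hs : T s) (ht : B t) (hu' : T u) :
    (3 * m : ℤ) - 6 * q + 1 ≤ n := by
  classical
  obtain ⟨i, hi, him⟩ := Finset.exists_max_image ((Finset.range t).filter T) f
    ⟨s, by simp [hst, hs]⟩
  obtain ⟨j, hj, hjm⟩ := Finset.exists_min_image ((Finset.Ioc t n).filter T) f
    ⟨u, by simp [htu, hu, hu']⟩
  simp only [Finset.mem_filter, Finset.mem_range, Finset.mem_Ioc] at hi hj him hjm
  have h1 := hsep i t (by omega) (by omega) hi.2 ht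
  have h2 := hsep j t (by omega) (by omega) hj.2 ht
  have h3 := le_add_of_steps hf (Nat.zero_le i) (by omega)
  have h4 := le_add_of_steps hf hj.1.2 le_rfl
  have h5 : f j ≤ f i + 2 * q := by
    by_contra hc
    have h6 := hpos i (by omega)
    have h7 := hpos j (by omega)
    obtain ⟨l, hl, hlT, h8, h9⟩ := hT (f i + 1).toNat (by omega)
    rcases lt_trichotomy l t with h10 | rfl | h10
    · have := him l ⟨h10, hlT⟩
      omega
    · have := hsep l l (by omega) (by omega) hlT ht
      simp at this
      omega
    · have := hjm l ⟨⟨h10, hl⟩, hlT⟩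
      omega
  rw [abs_of_neg (by omega)] at h1
  rw [abs_of_pos (by omega)] at h2
  omega

/-- The walk climbs to height `m - 2q`, crosses to a height below `2q`, and climbs again. -/
theorem le_of_visit_before (hf : ∀ i < n, f i ≤ f (i + 1) + 1 ∧ f (i + 1) ≤ f i + 1)
    (h0 : f 0 = 0) (hn : f n = m - 1)
    (hsep : ∀ i j, i ≤ n → j ≤ n → T i → B j → (m : ℤ) - 2 * q + 1 ≤ |(i : ℤ) - j|)
    {s t : ℕ} (hst : s < t) (ht' : t ≤ n) (hs : T s) (ht : B t) (hfs : m - 2 * q ≤ f s)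
    (hft : f t < 2 * q) : (3 * m : ℤ) - 6 * q + 1 ≤ n := by
  have h1 := hsep s t (by omega) (by omega) hs ht
  have h3 := le_add_of_steps hf (Nat.zero_le s) (by omega)
  have h4 := le_add_of_steps hf ht' le_rfl
  rw [abs_of_neg (by omega)] at h1
  omega

/-- A walk from row `0` to row `m - 1` that visits all windows at both sides is long. -/
theorem le_of_visits (hf : ∀ i < n, f i ≤ f (i + 1) + 1 ∧ f (i + 1) ≤ f i + 1)
    (h0 : f 0 = 0) (hn : f n = m - 1) (hpos : ∀ i ≤ n, 0 ≤ f i ∧ f i ≤ m - 1) (hq : 2 * q ≤ m)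
    (hsep : ∀ i j, i ≤ n → j ≤ n → T i → B j → (m : ℤ) - 2 * q + 1 ≤ |(i : ℤ) - j|)
    (hT : ∀ j : ℕ, j + 2 * q ≤ m → ∃ i ≤ n, T i ∧ j ≤ f i ∧ f i < j + 2 * q)
    (hB : ∀ j : ℕ, j + 2 * q ≤ m → ∃ i ≤ n, B i ∧ j ≤ f i ∧ f i < j + 2 * q) :
    (3 * m : ℤ) - 6 * q + 1 ≤ n := by
  have hsep' : ∀ i j, i ≤ n → j ≤ n → B i → T j → (m : ℤ) - 2 * q + 1 ≤ |(i : ℤ) - j| :=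
    fun i j hi hj h1 h2 => abs_sub_comm (i : ℤ) j ▸ hsep j i hj hi h2 h1
  have hne : ∀ i j, i ≤ n → T i → B j → i ≠ j := by
    rintro i j hi h1 h2 rfl
    have := hsep i i hi hi h1 h2
    simp at this
    omega
  obtain ⟨s, hs, hsT, hs1, -⟩ := hT (m - 2 * q) (by omega)
  obtain ⟨s', hs', hsT', -, hs2⟩ := hT 0 (by omega)
  obtain ⟨t, ht, htB, -, ht2⟩ := hB 0 (by omega)
  obtain ⟨t', ht', htB', ht1, -⟩ := hB (m - 2 * q) (by omega)
  rcases (hne s t hs hsT htB).lt_or_gt with h1 | h1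
  · exact le_of_visit_before hf h0 hn hsep h1 ht hsT htB (by omega) (by omega)
  -- Now `t < s`. If also `s' < t'`, the order of `s'` and `t` decides which of the patterns T-B-T
  -- and B-T-B occurs.
  rcases (hne s' t' hs' hsT' htB').lt_or_gt with h2 | h2
  · rcases (hne s' t hs' hsT' htB).lt_or_gt with h3 | h3
    · exact le_of_visit_between hf h0 hn hpos hq hsep hT h3 h1 hs hsT' htB hsT
    · exact le_of_visit_between hf h0 hn hpos hq hsep' hB h3 h2 ht' htB hsT' htB'
  · exact le_of_visit_before hf h0 hn hsep' h2 hs' htB' hsT' (by omega) (by omega)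

end Windows

/-! ### A path of king moves across a square. -/

section

variable {x y : ℤ} {H : Finset (ℤ × ℤ)} {k m : ℕ}

theorem Config.bound_of_kingPath (h : Config (rect x y m m) H k) {n : ℕ} {p : ℕ → ℤ × ℤ}
    (hp : KingPath H n p) (hp0 : (p 0).2 = y) (hpn : (p n).2 = y + m - 1) :
    (5 * m - 2) / 3 ≤ H.card + k := by
  have hXH := Finset.card_le_card hp.trace_subset
  have hX := hp.card_trace
  have hmn := le_add_of_steps hp.snd (Nat.zero_le n) le_rfl
  -- This is the largest `q` with `6 * q ≤ 3 * m - n`, which is what `le_of_visits` contradicts. For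
  -- `q = 0` the path alone is long enough.
  obtain ⟨q, hq⟩ : ∃ q, q = (3 * m - n) / 6 := ⟨_, rfl⟩
  rcases Nat.eq_zero_or_pos q with hq0 | hq0
  · omega
  have hD : ∀ w' P' y', w' ≤ q → P' ≤ 2 * q →
      Bound (rect x y' w' P') (min P' (2 * w')) := fun w' P' y' _ _ =>
    (bound_rect _ P' w' y' x rfl).swap
  by_cases hfree : ∃ j : ℕ, j + 2 * q ≤ m ∧ ∀ z ∈ trace n p, z ∉ rect x (y + j) q (2 * q)
  · obtain ⟨j, hj, hfree⟩ := hfree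
    have := h.bound_of_left_free hp.trace_subset hfree (by omega) (by omega)
      (by push_cast; omega) hD
    omega
  by_cases hfree' : ∃ j : ℕ, j + 2 * q ≤ m ∧
      ∀ z ∈ trace n p, z ∉ rect (x + m - q) (y + j) q (2 * q)
  · obtain ⟨j, hj, hfree⟩ := hfree'
    have := h.bound_of_right_free hp.trace_subset hfree (by omega) (by omega)
      (by push_cast; omega) hD
    omega
  push Not at hfree hfree'
  have hmem : ∀ i ≤ n, (x ≤ (p i).1 ∧ (p i).1 < x + m) ∧ y ≤ (p i).2 ∧ (p i).2 < y + m :=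
    fun i hi => h.sub (hp.mem i hi)
  have := le_of_visits (f := fun i => (p i).2 - y) (n := n) (m := m) (q := q)
    (T := fun i => (p i).1 < x + q) (B := fun i => x + m - q ≤ (p i).1)
    (fun i hi => by have := hp.snd i hi; omega) (by omega)
    (by omega) (fun i hi => by have := hmem i hi; omega) (by omega)
    (fun i j hi hj hT hB => by
      rcases le_total i j with hij | hij
      · have := le_add_of_steps hp.fst hij hj
        rw [abs_of_nonpos (by omega)]
        omega
      · have := le_add_of_steps hp.fst hij hi
        rw [abs_of_nonneg (by omega)]
        omega)
    (fun j hj => by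
      obtain ⟨z, hz, hzr⟩ := hfree j hj
      obtain ⟨i, hi, rfl⟩ := mem_trace.1 hz
      rw [mem_rect] at hzr
      push_cast at hzr
      exact ⟨i, hi, by omega, by omega, by omega⟩)
    (fun j hj => by
      obtain ⟨z, hz, hzr⟩ := hfree' j hj
      obtain ⟨i, hi, rfl⟩ := mem_trace.1 hz
      rw [mem_rect] at hzr
      push_cast at hzr
      exact ⟨i, hi, by omega, by omega, by omega⟩)
  omega

theorem Config.bound_of_free_columns (h : Config (rect x y m m) H k) (hm : 1 ≤ m)
    (ih : ∀ k' < k, ∀ H', Config (rect x y m m) H' k' → (5 * m - 2) / 3 ≤ H'.card + k')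
    (hL : ∀ z ∈ H, z.1 ≠ x) (hR : ∀ z ∈ H, z.1 ≠ x + m - 1)
    (hB : ∀ p ∈ H, ∀ q ∈ H, p.2 = y → q.2 = y → p = q)
    (hT : ∀ p ∈ H, ∀ q ∈ H, p.2 = y + m - 1 → q.2 = y + m - 1 → p = q) :
    (5 * m - 2) / 3 ≤ H.card + k := by
  rcases h.exists_insert_or_separated hm hL hR hB hT with ⟨k', rfl, H', hH', hc⟩ | hsep
  · have := ih k' (by omega) H' hc
    omega
  · obtain ⟨n, p, hp, hp0, hpn⟩ := exists_kingPath_of_separated hm hm h.sub hsep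
    exact h.bound_of_kingPath hp hp0 hpn

end

/-! ### The bound for squares and its transfer to the grid graph. -/

section

variable {x y : ℤ} {H : Finset (ℤ × ℤ)} {k m : ℕ}

/-- If the border of a square contains at most one element of `H`, and it is at a corner, then a
label can be traded for a deleted vertex. -/
theorem Config.exists_insert_of_unique (h : Config (rect x y m m) H k) (hm : 2 ≤ m) {p : ℤ × ℤ}
    (hp : (p.1 = x ∨ p.1 = x + m - 1) ∧ (p.2 = y ∨ p.2 = y + m - 1))
    (hu : ∀ z ∈ H, z.1 = x ∨ z.1 = x + m - 1 ∨ z.2 = y ∨ z.2 = y + m - 1 → z = p) :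
    ∃ k', k = k' + 1 ∧ ∃ H', H'.card = H.card + 1 ∧ Config (rect x y m m) H' k' := by
  have key : ∀ {H : Finset (ℤ × ℤ)} {p : ℤ × ℤ}, Config (rect x y m m) H k → p.1 = x → p.2 = y →
      (∀ z ∈ H, z.1 = x ∨ z.1 = x + m - 1 ∨ z.2 = y ∨ z.2 = y + m - 1 → z = p) →
      ∃ k', k = k' + 1 ∧ ∃ H', H'.card = H.card + 1 ∧ Config (rect x y m m) H' k' := by
    intro H p h h1 h2 hu
    refine h.exists_insert_of_corner (by omega) (fun z hz h => ?_) (fun z hz h => ?_)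
      (fun z hz h => ?_) (fun z hz h => ?_)
    all_goals
      have := hu z hz (by simp [h])
      subst this
      omega
  have key' : ∀ {H : Finset (ℤ × ℤ)} {p : ℤ × ℤ}, Config (rect x y m m) H k →
      (p.1 = x ∨ p.1 = x + m - 1) → p.2 = y →
      (∀ z ∈ H, z.1 = x ∨ z.1 = x + m - 1 ∨ z.2 = y ∨ z.2 = y + m - 1 → z = p) →
      ∃ k', k = k' + 1 ∧ ∃ H', H'.card = H.card + 1 ∧ Config (rect x y m m) H' k' := by
    intro H p h h1 h2 hu
    rcases h1 with h1 | h1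
    · exact key h h1 h2 hu
    · have := key (p := GridRank.flipX (2 * x + m - 1) p) h.flipX (by simp only [flipX_apply]; omega) h2 ?_
      · simpa using this
      · intro z hz hzb
        obtain ⟨u, hu', rfl⟩ := Finset.mem_map.1 hz
        simp only [Equiv.coe_toEmbedding, flipX_apply] at hzb ⊢
        rw [hu u hu' (by omega)]
  rcases hp with ⟨h1, h2 | h2⟩
  · exact key' h h1 h2 hu
  · have := key' (p := GridRank.flipY (2 * y + m - 1) p) h.flipY h1 (by simp only [flipY_apply]; omega) ?_
    · simpa using this
    · intro z hz hzb
      obtain ⟨u, hu', rfl⟩ := Finset.mem_map.1 hz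
      simp only [Equiv.coe_toEmbedding, flipY_apply] at hzb ⊢
      rw [hu u hu' (by omega)]

/-- The bound for a square. -/
theorem bound_square (m : ℕ) : ∀ x y, Bound (rect x y m m) ((5 * m - 2) / 3) := by
  induction m using Nat.strong_induction_on with
  | _ m hS =>
  suffices hk : ∀ k x y H, Config (rect x y m m) H k → (5 * m - 2) / 3 ≤ H.card + k from
    fun x y H k => hk k x y H
  intro k
  induction k using Nat.strong_induction_on with
  | _ k ih =>
  intro x y H h
  rcases Nat.eq_zero_or_pos m with rfl | hm
  · simp
  have c1 : ∀ z ∈ H, ∀ z' ∈ H, z ≠ z' → (z.1 = x ∨ z.2 = y) → (z'.1 = x ∨ z'.2 = y) →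
      (5 * m - 2) / 3 ≤ H.card + k := fun z hz z' hz' hne h1 h2 =>
    h.bound_of_mem_corner hS ⟨z, hz, z', hz', hne, h1, h2⟩
  have c2 : ∀ z ∈ H, ∀ z' ∈ H, z ≠ z' → (z.1 = x + m - 1 ∨ z.2 = y) →
      (z'.1 = x + m - 1 ∨ z'.2 = y) → (5 * m - 2) / 3 ≤ H.card + k := by
    intro z hz z' hz' hne h1 h2
    simpa using h.flipX.bound_of_mem_corner hS ⟨_, Finset.mem_map_of_mem _ hz, _,
      Finset.mem_map_of_mem _ hz', fun he => hne ((flipX _).injective he), by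
        simp only [Equiv.coe_toEmbedding, flipX_apply]; omega⟩
  have c3 : ∀ z ∈ H, ∀ z' ∈ H, z ≠ z' → (z.1 = x ∨ z.2 = y + m - 1) →
      (z'.1 = x ∨ z'.2 = y + m - 1) → (5 * m - 2) / 3 ≤ H.card + k := by
    intro z hz z' hz' hne h1 h2
    simpa using h.flipY.bound_of_mem_corner hS ⟨_, Finset.mem_map_of_mem _ hz, _,
      Finset.mem_map_of_mem _ hz', fun he => hne ((flipY _).injective he), by
        simp only [Equiv.coe_toEmbedding, flipY_apply]; omega⟩
  have c4 : ∀ z ∈ H, ∀ z' ∈ H, z ≠ z' → (z.1 = x + m - 1 ∨ z.2 = y + m - 1) →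
      (z'.1 = x + m - 1 ∨ z'.2 = y + m - 1) → (5 * m - 2) / 3 ≤ H.card + k := by
    intro z hz z' hz' hne h1 h2
    simpa using h.flipY.flipX.bound_of_mem_corner hS ⟨_, Finset.mem_map_of_mem _
      (Finset.mem_map_of_mem _ hz), _, Finset.mem_map_of_mem _ (Finset.mem_map_of_mem _ hz'),
      fun he => hne ((flipY _).injective ((flipX _).injective he)), by
        simp only [Equiv.coe_toEmbedding, flipX_apply, flipY_apply]; omega⟩
  by_contra hcon
  -- If the bound fails, each pair of adjacent sides contains at most one element of `H`.
  have c1 := fun z hz z' hz' h1 h2 => by_contra fun hne => hcon (c1 z hz z' hz' hne h1 h2)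
  have c2 := fun z hz z' hz' h1 h2 => by_contra fun hne => hcon (c2 z hz z' hz' hne h1 h2)
  have c3 := fun z hz z' hz' h1 h2 => by_contra fun hne => hcon (c3 z hz z' hz' hne h1 h2)
  have c4 := fun z hz z' hz' h1 h2 => by_contra fun hne => hcon (c4 z hz z' hz' hne h1 h2)
  have hX : ∃ p ∈ H, p.1 = x ∨ p.1 = x + m - 1 := by
    by_contra hno
    push Not at hno
    exact hcon (h.bound_of_free_columns hm (fun k' hk' H' => ih k' hk' x y H')
      (fun z hz => (hno z hz).1) (fun z hz => (hno z hz).2)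
      (fun z hz z' hz' h1 h2 => c1 z hz z' hz' (.inr h1) (.inr h2))
      (fun z hz z' hz' h1 h2 => c4 z hz z' hz' (.inr h1) (.inr h2)))
  have hY : ∃ q ∈ H, q.2 = y ∨ q.2 = y + m - 1 := by
    by_contra hno
    push Not at hno
    refine hcon ?_
    simpa using h.swap.bound_of_free_columns hm (fun k' hk' H' => ih k' hk' y x H')
      (by simpa using fun a b hz => (hno (b, a) hz).1)
      (by simpa using fun a b hz => (hno (b, a) hz).2)
      (fun z hz z' hz' h1 h2 => by
        obtain ⟨u, hu, rfl⟩ := Finset.mem_map.1 hz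
        obtain ⟨u', hu', rfl⟩ := Finset.mem_map.1 hz'
        rw [c1 u hu u' hu' (.inl h1) (.inl h2)])
      (fun z hz z' hz' h1 h2 => by
        obtain ⟨u, hu, rfl⟩ := Finset.mem_map.1 hz
        obtain ⟨u', hu', rfl⟩ := Finset.mem_map.1 hz'
        rw [c4 u hu u' hu' (.inl h1) (.inl h2)])
  obtain ⟨p, hp, hpx⟩ := hX
  obtain ⟨q, hq, hqy⟩ := hY
  -- A vertical and a horizontal side are always adjacent, so the two elements coincide in a corner,
  -- which is then the only element of `H` on the border.
  have hpq : p = q := by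
    rcases hpx with h1 | h1 <;> rcases hqy with h2 | h2
    · exact c1 p hp q hq (.inl h1) (.inr h2)
    · exact c3 p hp q hq (.inl h1) (.inr h2)
    · exact c2 p hp q hq (.inl h1) (.inr h2)
    · exact c4 p hp q hq (.inl h1) (.inr h2)
  subst hpq
  have hcard := Finset.card_pos.2 ⟨p, hp⟩
  -- For `m = 1` the bound is 1, and `p` alone attains it; hence `2 ≤ m`.
  obtain ⟨k', rfl, H', hH', hc⟩ := h.exists_insert_of_unique (by omega) ⟨hpx, hqy⟩ fun z hz hzb => by
    rcases hpx with h1 | h1 <;> rcases hqy with h2 | h2 <;> rcases hzb with h3 | h3 | h3 | h3 <;>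
    first
    | (refine c1 z hz p hp ?_ ?_ <;> omega)
    | (refine c2 z hz p hp ?_ ?_ <;> omega)
    | (refine c3 z hz p hp ?_ ?_ <;> omega)
    | (refine c4 z hz p hp ?_ ?_ <;> omega)
  have := ih k' (by omega) x y H' hc
  omega

/-- The position of a vertex of the grid graph in the lattice. -/
def toLattice {m : ℕ} (w : Fin m × Fin m) : ℤ × ℤ := (((w.1 : ℕ) : ℤ), ((w.2 : ℕ) : ℤ))

theorem exists_toLattice {m : ℕ} {z : ℤ × ℤ} (hz : z ∈ rect 0 0 m m) :
    ∃ w : Fin m × Fin m, z = toLattice w := by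
  rw [mem_rect] at hz
  exact ⟨(⟨z.1.toNat, by omega⟩, ⟨z.2.toNat, by omega⟩),
    Prod.ext (by simp only [toLattice]; omega) (by simp only [toLattice]; omega)⟩

/-- Lattice walks in a square with bounded labels give such walks in the grid graph. -/
theorem exists_walk_of_reach {m : ℕ} {g : ℤ × ℤ → ℕ} {c : ℕ} {u' v' : Fin m × Fin m}
    (hr : Reach {w | w ∈ rect 0 0 m m ∧ g w ≤ c} (toLattice u') (toLattice v'))
    (hgu : g (toLattice u') ≤ c) :
    ∃ p : (gridGraph m m).Walk u' v', ∀ w ∈ p.support, g (toLattice w) ≤ c := by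
  obtain ⟨v, hv⟩ : ∃ v, v = toLattice v' := ⟨_, rfl⟩
  rw [← hv] at hr
  induction hr generalizing v' with
  | refl =>
    have : u' = v' := by
      simp only [toLattice, Prod.mk.injEq] at hv
      exact Prod.ext (Fin.ext (by omega)) (Fin.ext (by omega))
    subst this
    exact ⟨.nil, by simpa using hgu⟩
  | @tail z w _ h ih =>
    obtain ⟨hadj, ⟨hz, -⟩, hw, hgw⟩ := h
    obtain ⟨z', rfl⟩ := exists_toLattice hz
    obtain ⟨p, hp⟩ := ih rfl
    have hadj' : (gridGraph m m).Adj z' v' := by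
      rw [hv] at hadj
      simp only [gridGraph, SimpleGraph.boxProd_adj, SimpleGraph.pathGraph_adj, Fin.ext_iff]
      simp only [Adj, toLattice] at hadj
      omega
    refine ⟨p.concat hadj', fun w' hw' => ?_⟩
    rw [SimpleGraph.Walk.support_concat, List.mem_append,
      List.mem_singleton] at hw'
    rcases hw' with hw' | rfl
    · exact hp _ hw'
    · exact hv ▸ hgw

theorem ranked_of_isRanking {m k : ℕ} {f : Fin m × Fin m → ℕ} (hf : IsRanking (gridGraph m m) k f) :
    Ranked (rect 0 0 m m) k := by
  classical
  let g : ℤ × ℤ → ℕ := fun z =>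
    if h : z.1.toNat < m ∧ z.2.toNat < m then f (⟨z.1.toNat, h.1⟩, ⟨z.2.toNat, h.2⟩) else 0
  have hg : ∀ w : Fin m × Fin m, g (toLattice w) = f w := fun w => by simp [g, toLattice]
  refine ⟨g, fun v hv => ?_, fun u hu v hv huv he hr => ?_⟩
  · obtain ⟨w, rfl⟩ := exists_toLattice hv
    rw [hg]
    exact hf.1 w
  · obtain ⟨u', rfl⟩ := exists_toLattice hu
    obtain ⟨v', rfl⟩ := exists_toLattice hv
    obtain ⟨p, hp⟩ := exists_walk_of_reach hr le_rfl
    rw [hg, hg] at he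
    -- A ranking speaks of paths only, so the walk is shortened to a path on some of its vertices.
    obtain ⟨w, hw, hlt⟩ := hf.2 u' v' (fun h => huv (by rw [h])) he p.bypass p.bypass_isPath
    have := hp w (p.support_bypass_subset_support hw)
    rw [hg, hg] at this
    omega

/-- With `H` empty, the whole sum consists of labels. The constant 4/3 that results is smaller than
25/9. -/
theorem five_mul_le_of_isRanking {m k : ℕ} {f : Fin m × Fin m → ℕ}
    (hf : IsRanking (gridGraph m m) k f) : 5 * m ≤ 3 * k + 4 := by
  have := bound_square m 0 0 ∅ k ⟨by simp, (ranked_of_isRanking hf).mono fun z hz => hz.1.1⟩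
  rw [Finset.card_empty] at this
  omega

end

end GridRank

theorem mainTheorem3 (m : ℕ) (hm : 1 ≤ m) :
    (5 / 3 : ℝ) * (m : ℝ) - 25 / 9 ≤ (rankNumber (gridGraph m m) : ℝ) := by
  obtain ⟨f, hf⟩ := (isLeast_rankNumber (gridGraph m m)).1
  have h : (5 : ℝ) * m ≤ 3 * rankNumber (gridGraph m m) + 4 := by
    exact_mod_cast GridRank.five_mul_le_of_isRanking hf
  linarith
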